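/- **Conventions.** Manifolds are smooth, finite-dimensional, Hausdorff, second countable and without boundary. A groupoid with source $s$ and end $e$ composes $a,b$ to $ab$ when $e(a)=s(b)$. It is a Lie groupoid if its sets of objects and arrows are smooth manifolds, $s$ and $e$ are surjective submersions, and composition (on the embedded submanifold of composable pairs), identities and inversion are smooth. A double groupoid $(\mathcal B;\mathcal V,\mathcal H;\mathcal P)$ is a set $\mathcal B$ of boxes with two groupoid structures, one over $\mathcal V$ (left side $l$, right side $r$) and one over $\mathcal H$ (top side $t$, bottom side $b$), where $\mathcal V$ (source $t$, end $b$) and $\mathcal H$ (source $l$, end $r$) are groupoids over $\mathcal P$, such that the structure maps of each structure are morphisms with respect to the other. It is *slim* if a box is determined by its four sides. It is a *double Lie groupoid* if all four groupoids are Lie groupoids and the double source map $\mathcal B\to\{(x,f)\in\mathcal H\times\mathcal V: l(x)=t(f)\}$, $A\mapsto(t(A),l(A))$, is a surjective submersion. **Statement.** Let $\mathcal V$ (with source $t$ and end $b$), $\mathcal H$ (with source $l$ and end $r$) and $\mathcal D$ be Lie groupoids over the same manifold $\mathcal P$, and let $i:\mathcal H\to\mathcal D$ and $j:\mathcal V\to\mathcal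 D$ be smooth morphisms of groupoids that are the identity on $\mathcal P$. Suppose that $i$ and $j$ are transversal at the identities, that is, for every $p\in\mathcal P$, $$(T_{\mathrm{id}_p}i)(T_{\mathrm{id}_p}\mathcal H)+(T_{\mathrm{id}_p}j)(T_{\mathrm{id}_p}\mathcal V)=T_{\mathrm{id}_p}\mathcal D .$$ 1. The fibre products $\{(x,g)\in\mathcal H\times\mathcal V: r(x)=t(g)\}$ and $\{(f,y)\in\mathcal V\times\mathcal H: b(f)=l(y)\}$ are embedded submanifolds of $\mathcal H\times\mathcal V$ and $\mathcal V\times\mathcal H$, and the maps $\Phi(x,g)=i(x)j(g)$ and $\Psi(f,y)=j(f)i(y)$ from them to $\mathcal D$ are submersions. 2. Suppose moreover that $(\mathcal D,j,i)$ is a $(\mathcal V,\mathcal H)$-factorization of $\mathcal D$, that is, every arrow of $\mathcal D$ has the form $j(f)i(y)$ with $f\in\mathcal V$, $y\in\mathcal H$, $b(f)=l(y)$. Let $\square(\mathcal D,j,i)$ be the double groupoid whose boxes are the quadruples $((f,y),(x,g))\in(\mathcal V\times\mathcal H)\times(\mathcal H\times\mathcal V)$ (left side $f$, bottom $y$, top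 $x$, right side $g$) with $l(x)=t(f)$, $r(x)=t(g)$, $l(y)=b(f)$, $r(y)=b(g)$ and $i(x)j(g)=j(f)i(y)$, and whose horizontal and vertical compositions multiply the sides. Then the set of boxes is an embedded submanifold of $(\mathcal V\times\mathcal H)\times(\mathcal H\times\mathcal V)$, and with this manifold structure $\square(\mathcal D,j,i)$ is a slim double Lie groupoid. -/

import Mathlib

open scoped Manifold ContDiff

/-! ### Groupoids, presented by their sets of objects and arrows -/

/-- A groupoid with set of objects `P` and set of arrows `G`: source and end maps, identities,
composition `ab` of arrows with `e(a) = s(b)`, and inverses. -/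
structure Gpd (P G : Type*) where
  src : G → P
  tgt : G → P
  one : P → G
  mul : ∀ a b : G, tgt a = src b → G
  inv : G → G
  src_one : ∀ p, src (one p) = p
  tgt_one : ∀ p, tgt (one p) = p
  src_mul : ∀ a b h, src (mul a b h) = src a
  tgt_mul : ∀ a b h, tgt (mul a b h) = tgt b
  src_inv : ∀ a, src (inv a) = tgt a
  tgt_inv : ∀ a, tgt (inv a) = src a
  one_mul : ∀ a, mul (one (src a)) a (tgt_one _) = a
  mul_one : ∀ a, mul a (one (tgt a)) (src_one _).symm = a
  mul_assoc : ∀ a b c (hab : tgt a = src b) (hbc : tgt b = src c),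
    mul (mul a b hab) c ((tgt_mul a b hab).trans hbc) =
      mul a (mul b c hbc) (hab.trans (src_mul b c hbc).symm)
  mul_inv : ∀ a, mul a (inv a) (src_inv a).symm = one (src a)
  inv_mul : ∀ a, mul (inv a) a (tgt_inv a) = one (tgt a)

/-- The map `φ` on arrows, together with `φ₀` on objects, is a morphism of groupoids. -/
structure IsGpdHom {P G P' G' : Type*} (𝒢 : Gpd P G) (𝒢' : Gpd P' G')
    (φ : G → G') (φ₀ : P → P') : Prop where
  src : ∀ a, 𝒢'.src (φ a) = φ₀ (𝒢.src a)
  tgt : ∀ a, 𝒢'.tgt (φ a) = φ₀ (𝒢.tgt a)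
  one : ∀ p, φ (𝒢.one p) = 𝒢'.one (φ₀ p)
  mul : ∀ a b (h : 𝒢.tgt a = 𝒢.src b),
    φ (𝒢.mul a b h) =
      𝒢'.mul (φ a) (φ b) ((tgt a).trans ((congrArg φ₀ h).trans (src b).symm))

/-- A double groupoid `(B; V, H; P)`. The side groupoids are `vert` (arrows `V`, source = top,
end = bottom) and `horiz` (arrows `H`, source = left, end = right). The set of boxes `B` carries
the horizontal groupoid structure `hor` over `V` (source = left side, end = right side) and the
vertical groupoid structure `ver` over `H` (source = top side, end = bottom side). The structure
maps of each structure are morphisms with respect to the other; for the two compositions this is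
the `interchange` law, besides the compatibility with sources, ends and identities that the
other fields contain. -/
structure DoubleGpd (P V H B : Type*) where
  vert : Gpd P V
  horiz : Gpd P H
  hor : Gpd V B
  ver : Gpd H B
  hor_src : IsGpdHom ver vert hor.src horiz.src
  hor_tgt : IsGpdHom ver vert hor.tgt horiz.tgt
  hor_one : IsGpdHom vert ver hor.one horiz.one
  hor_inv : IsGpdHom ver ver hor.inv horiz.inv
  ver_src : IsGpdHom hor horiz ver.src vert.src
  ver_tgt : IsGpdHom hor horiz ver.tgt vert.tgt
  ver_one : IsGpdHom horiz hor ver.one vert.one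
  ver_inv : IsGpdHom hor hor ver.inv vert.inv
  interchange : ∀ (A B' C D : B) (hAB : hor.tgt A = hor.src B') (hCD : hor.tgt C = hor.src D)
    (hAC : ver.tgt A = ver.src C) (hBD : ver.tgt B' = ver.src D),
    ver.mul (hor.mul A B' hAB) (hor.mul C D hCD)
        (by simp only [ver_tgt.mul, ver_src.mul, hAC, hBD]) =
      hor.mul (ver.mul A C hAC) (ver.mul B' D hBD)
        (by simp only [hor_tgt.mul, hor_src.mul, hAB, hCD])

section Boxes

variable {P V H B : Type*}

/-- The fibre product `{(x, f) ∈ H × V : l(x) = t(f)}`. -/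
def cornerSet (𝒱 : Gpd P V) (ℋ : Gpd P H) : Set (H × V) :=
  {q | ℋ.src q.1 = 𝒱.src q.2}

/-- The double source map `A ↦ (t(A), l(A))` of a double groupoid. -/
def DoubleGpd.doubleSource (ℬ : DoubleGpd P V H B) (A : B) : cornerSet ℬ.vert ℬ.horiz :=
  ⟨(ℬ.ver.src A, ℬ.hor.src A), (ℬ.hor_src.src A).symm⟩

/-- The boxes of the coarse double groupoid `□(V, H)`: quadruples `((f, y), (x, g))` with left side
`f`, bottom side `y`, top side `x` and right side `g`, whose corners match. -/
def coarseBoxSet (𝒱 : Gpd P V) (ℋ : Gpd P H) : Set ((V × H) × (H × V)) :=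
  {q | 𝒱.tgt q.1.1 = ℋ.src q.1.2 ∧ ℋ.tgt q.2.1 = 𝒱.src q.2.2 ∧
    ℋ.src q.2.1 = 𝒱.src q.1.1 ∧ ℋ.tgt q.1.2 = 𝒱.tgt q.2.2}

/-- The map `Π : B → □(V, H)` that sends a box to its four sides. -/
def DoubleGpd.sides (ℬ : DoubleGpd P V H B) (A : B) : coarseBoxSet ℬ.vert ℬ.horiz :=
  ⟨((ℬ.hor.src A, ℬ.ver.tgt A), (ℬ.ver.src A, ℬ.hor.tgt A)),
    ℬ.hor_src.tgt A, (ℬ.hor_tgt.src A).symm, (ℬ.hor_src.src A).symm, (ℬ.hor_tgt.tgt A).symm⟩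

/-- A double groupoid is slim if each box is determined by its four sides. -/
def DoubleGpd.IsSlim (ℬ : DoubleGpd P V H B) : Prop :=
  Function.Injective ℬ.sides

end Boxes

/-! ### Diagrams of groupoids and the associated double groupoid -/

/-- A diagram `(D, j, i)` over `H` and `V`: morphisms `i : H → D` and `j : V → D` of groupoids over
the same base `P`. -/
structure GpdDiagram {P V H D : Type*} (𝒱 : Gpd P V) (ℋ : Gpd P H) (𝒟 : Gpd P D) where
  i : H → D
  j : V → D
  hom_i : IsGpdHom ℋ 𝒟 i id
  hom_j : IsGpdHom 𝒱 𝒟 j id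

namespace GpdDiagram

variable {P V H D : Type*} {𝒱 : Gpd P V} {ℋ : Gpd P H} {𝒟 : Gpd P D} (Δ : GpdDiagram 𝒱 ℋ 𝒟)

theorem tgt_i_eq {x : H} {g : V} (h : ℋ.tgt x = 𝒱.src g) : 𝒟.tgt (Δ.i x) = 𝒟.src (Δ.j g) := by
  rw [Δ.hom_i.tgt, Δ.hom_j.src]; exact h

theorem tgt_j_eq {f : V} {y : H} (h : 𝒱.tgt f = ℋ.src y) : 𝒟.tgt (Δ.j f) = 𝒟.src (Δ.i y) := by
  rw [Δ.hom_j.tgt, Δ.hom_i.src]; exact h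

/-- The product `i(x) j(g)`, for `r(x) = t(g)`. -/
def ij (x : H) (g : V) (h : ℋ.tgt x = 𝒱.src g) : D := 𝒟.mul (Δ.i x) (Δ.j g) (Δ.tgt_i_eq h)

/-- The product `j(f) i(y)`, for `b(f) = l(y)`. -/
def ji (f : V) (y : H) (h : 𝒱.tgt f = ℋ.src y) : D := 𝒟.mul (Δ.j f) (Δ.i y) (Δ.tgt_j_eq h)

/-- The diagram is a factorization of `D`: every arrow of `D` is a product `j(f) i(y)`. -/
def IsFactorization : Prop :=
  ∀ a : D, ∃ (f : V) (y : H) (h : 𝒱.tgt f = ℋ.src y), Δ.ji f y h = a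

/-- The boxes of `□(D, j, i)`: the boxes of `□(V, H)` with `i(x) j(g) = j(f) i(y)` in `D`. -/
def boxSet : Set ((V × H) × (H × V)) :=
  {q | ∃ hq : q ∈ coarseBoxSet 𝒱 ℋ,
    Δ.ij q.2.1 q.2.2 hq.2.1 = Δ.ji q.1.1 q.1.2 hq.1}

end GpdDiagram

namespace Gpd

variable {P G : Type*} (𝒢 : Gpd P G)

theorem mul_congr {a a' b b' : G} (ha : a = a') (hb : b = b') (h : 𝒢.tgt a = 𝒢.src b)
    (h' : 𝒢.tgt a' = 𝒢.src b') : 𝒢.mul a b h = 𝒢.mul a' b' h' := by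
  subst ha hb; rfl

theorem one_mul' {p : P} {a : G} (h : 𝒢.tgt (𝒢.one p) = 𝒢.src a) :
    𝒢.mul (𝒢.one p) a h = a := by
  have : p = 𝒢.src a := (𝒢.tgt_one p).symm.trans h
  subst this; exact 𝒢.one_mul a

theorem mul_one' {p : P} {a : G} (h : 𝒢.tgt a = 𝒢.src (𝒢.one p)) :
    𝒢.mul a (𝒢.one p) h = a := by
  have : p = 𝒢.tgt a := (𝒢.src_one p).symm.trans h.symm
  subst this; exact 𝒢.mul_one a

end Gpd

namespace Gpd

variable {P G : Type*} (𝒢 : Gpd P G)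

theorem mul_paste {x x' g g' f y y' : G} (hxg : 𝒢.tgt x = 𝒢.src g) (hfy : 𝒢.tgt f = 𝒢.src y)
    (hxg' : 𝒢.tgt x' = 𝒢.src g') (hgy : 𝒢.tgt g = 𝒢.src y') (hxx : 𝒢.tgt x = 𝒢.src x')
    (hyy : 𝒢.tgt y = 𝒢.src y')
    (e : 𝒢.mul x g hxg = 𝒢.mul f y hfy) (e' : 𝒢.mul x' g' hxg' = 𝒢.mul g y' hgy) :
    𝒢.mul (𝒢.mul x x' hxx) g' ((𝒢.tgt_mul _ _ _).trans hxg') =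
      𝒢.mul f (𝒢.mul y y' hyy) (hfy.trans (𝒢.src_mul _ _ _).symm) := by
  rw [𝒢.mul_assoc x x' g' hxx hxg', ← 𝒢.mul_assoc f y y' hfy hyy,
    𝒢.mul_congr rfl e' _ (hxg.trans (𝒢.src_mul _ _ _).symm), ← 𝒢.mul_assoc x g y' hxg hgy]
  exact 𝒢.mul_congr e rfl _ _

theorem mul_flip {x g f y : G} (hxg : 𝒢.tgt x = 𝒢.src g) (hfy : 𝒢.tgt f = 𝒢.src y)
    (hxf : 𝒢.src x = 𝒢.src f) (hgy : 𝒢.tgt g = 𝒢.tgt y)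
    (e : 𝒢.mul x g hxg = 𝒢.mul f y hfy) :
    𝒢.mul (𝒢.inv x) f ((𝒢.tgt_inv x).trans hxf) =
      𝒢.mul g (𝒢.inv y) (hgy.trans (𝒢.src_inv y).symm) := by
  have h1 : 𝒢.mul (𝒢.mul f y hfy) (𝒢.inv y) ((𝒢.tgt_mul _ _ _).trans (𝒢.src_inv y).symm) = f := by
    rw [𝒢.mul_assoc f y (𝒢.inv y) hfy (𝒢.src_inv y).symm,
      𝒢.mul_congr rfl (𝒢.mul_inv y) _ (hfy.trans (𝒢.src_one _).symm), 𝒢.mul_one']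
  have h2 : 𝒢.mul (𝒢.mul x g hxg) (𝒢.inv y)
      ((𝒢.tgt_mul _ _ _).trans (hgy.trans (𝒢.src_inv y).symm)) = f :=
    (𝒢.mul_congr e rfl _ _).trans h1
  rw [𝒢.mul_assoc x g (𝒢.inv y) hxg (hgy.trans (𝒢.src_inv y).symm)] at h2
  rw [𝒢.mul_congr rfl h2.symm _ ((𝒢.tgt_inv x).trans (𝒢.src_mul _ _ _).symm),
    ← 𝒢.mul_assoc (𝒢.inv x) x _ (𝒢.tgt_inv x) (hxg.trans (𝒢.src_mul _ _ _).symm),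
    𝒢.mul_congr (𝒢.inv_mul x) rfl _ ((𝒢.tgt_one _).trans (hxg.trans (𝒢.src_mul _ _ _).symm)),
    𝒢.one_mul']

theorem eq_inv {a b : G} (h : 𝒢.tgt a = 𝒢.src b) (e : 𝒢.mul a b h = 𝒢.one (𝒢.src a)) :
    b = 𝒢.inv a := by
  have h3 : 𝒢.mul (𝒢.inv a) (𝒢.mul a b h) ((𝒢.tgt_inv a).trans (𝒢.src_mul _ _ _).symm) = b := by
    rw [← 𝒢.mul_assoc (𝒢.inv a) a b (𝒢.tgt_inv a) h,
      𝒢.mul_congr (𝒢.inv_mul a) rfl _ ((𝒢.tgt_one _).trans h), 𝒢.one_mul']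
  rw [← h3, 𝒢.mul_congr rfl e _ ((𝒢.tgt_inv a).trans (𝒢.src_one _).symm), 𝒢.mul_one']

theorem inv_one (p : P) : 𝒢.inv (𝒢.one p) = 𝒢.one p :=
  (𝒢.eq_inv ((𝒢.tgt_one p).trans (𝒢.src_one p).symm) (by rw [𝒢.one_mul', 𝒢.src_one])).symm

theorem inv_mul_rev (a b : G) (h : 𝒢.tgt a = 𝒢.src b) :
    𝒢.inv (𝒢.mul a b h) = 𝒢.mul (𝒢.inv b) (𝒢.inv a)
      ((𝒢.tgt_inv b).trans (h.symm.trans (𝒢.src_inv a).symm)) := by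
  have hb := (𝒢.tgt_inv b).trans (h.symm.trans (𝒢.src_inv a).symm)
  refine (𝒢.eq_inv ((𝒢.tgt_mul _ _ _).trans
    ((𝒢.src_inv b).symm.trans (𝒢.src_mul _ _ hb).symm)) ?_).symm
  rw [𝒢.mul_assoc a b _ h ((𝒢.src_inv b).symm.trans (𝒢.src_mul _ _ hb).symm)]
  have h4 : 𝒢.mul b (𝒢.mul (𝒢.inv b) (𝒢.inv a) hb)
      ((𝒢.src_inv b).symm.trans (𝒢.src_mul _ _ hb).symm) = 𝒢.inv a := by
    rw [← 𝒢.mul_assoc b (𝒢.inv b) (𝒢.inv a) (𝒢.src_inv b).symm hb,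
      𝒢.mul_congr (𝒢.mul_inv b) rfl _ ((𝒢.tgt_one _).trans (h.symm.trans (𝒢.src_inv a).symm)),
      𝒢.one_mul']
  rw [𝒢.mul_congr rfl h4 _ (𝒢.src_inv a).symm, 𝒢.mul_inv, 𝒢.src_mul]

end Gpd

theorem IsGpdHom.map_inv {P G P' G' : Type*} {𝒢 : Gpd P G} {𝒢' : Gpd P' G'}
    {φ : G → G'} {φ₀ : P → P'} (hφ : IsGpdHom 𝒢 𝒢' φ φ₀) (a : G) :
    φ (𝒢.inv a) = 𝒢'.inv (φ a) := by
  refine 𝒢'.eq_inv (by rw [hφ.tgt, hφ.src, 𝒢.src_inv]) ?_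
  rw [← hφ.mul a (𝒢.inv a) (𝒢.src_inv a).symm, 𝒢.mul_inv, hφ.one, hφ.src]

namespace GpdDiagram

variable {P V H D : Type*} {𝒱 : Gpd P V} {ℋ : Gpd P H} {𝒟 : Gpd P D} (Δ : GpdDiagram 𝒱 ℋ 𝒟)

/-- The box with left side `f`, bottom side `y`, top side `x` and right side `g`. -/
def mkBox (f : V) (y x : H) (g : V) (hfy : 𝒱.tgt f = ℋ.src y) (hxg : ℋ.tgt x = 𝒱.src g)
    (hxf : ℋ.src x = 𝒱.src f) (hyg : ℋ.tgt y = 𝒱.tgt g) (e : Δ.ij x g hxg = Δ.ji f y hfy) :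
    Δ.boxSet :=
  ⟨((f, y), (x, g)), ⟨hfy, hxg, hxf, hyg⟩, e⟩

variable {Δ}

/-- The left side of a box. -/
def left (A : Δ.boxSet) : V := A.1.1.1
/-- The bottom side of a box. -/
def bot (A : Δ.boxSet) : H := A.1.1.2
/-- The top side of a box. -/
def top (A : Δ.boxSet) : H := A.1.2.1
/-- The right side of a box. -/
def right (A : Δ.boxSet) : V := A.1.2.2

theorem left_bot (A : Δ.boxSet) : 𝒱.tgt (left A) = ℋ.src (bot A) := A.2.1.1
theorem top_right (A : Δ.boxSet) : ℋ.tgt (top A) = 𝒱.src (right A) := A.2.1.2.1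
theorem top_left (A : Δ.boxSet) : ℋ.src (top A) = 𝒱.src (left A) := A.2.1.2.2.1
theorem bot_right (A : Δ.boxSet) : ℋ.tgt (bot A) = 𝒱.tgt (right A) := A.2.1.2.2.2
theorem box_eq (A : Δ.boxSet) :
    Δ.ij (top A) (right A) (top_right A) = Δ.ji (left A) (bot A) (left_bot A) := A.2.2

theorem box_ext {A B : Δ.boxSet} (h1 : left A = left B) (h2 : bot A = bot B) (h3 : top A = top B)
    (h4 : right A = right B) : A = B :=
  Subtype.ext (Prod.ext (Prod.ext h1 h2) (Prod.ext h3 h4))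

variable (Δ)

/-- The horizontal groupoid structure on the boxes of `□(D, j, i)`, over `V`. -/
def horGpd : Gpd V Δ.boxSet where
  src := left
  tgt := right
  one f := Δ.mkBox f (ℋ.one (𝒱.tgt f)) (ℋ.one (𝒱.src f)) f (ℋ.src_one _).symm (ℋ.tgt_one _)
    (ℋ.src_one _) (ℋ.tgt_one _) (by
      simp only [ij, ji, Δ.hom_i.one, id]
      rw [𝒟.one_mul', 𝒟.mul_one'])
  mul A B h := Δ.mkBox (left A)
    (ℋ.mul (bot A) (bot B) (by rw [bot_right, ← left_bot, h]))
    (ℋ.mul (top A) (top B) (by rw [top_right, top_left, h])) (right B)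
    (by rw [ℋ.src_mul, left_bot]) (by rw [ℋ.tgt_mul, top_right]) (by rw [ℋ.src_mul, top_left])
    (by rw [ℋ.tgt_mul, bot_right]) (by
      have hy : ℋ.tgt (bot A) = ℋ.src (bot B) := by rw [bot_right, ← left_bot, h]
      have hx : ℋ.tgt (top A) = ℋ.src (top B) := by rw [top_right, top_left, h]
      have e1 := box_eq A
      have e2 := box_eq B
      simp only [ij, ji] at e1 e2 ⊢
      have h5 : 𝒟.tgt (Δ.j (right A)) = 𝒟.src (Δ.i (bot B)) :=
        Δ.tgt_j_eq ((congrArg 𝒱.tgt h).trans (left_bot B))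
      rw [𝒟.mul_congr (congrArg Δ.j h.symm) rfl _ h5] at e2
      rw [𝒟.mul_congr (Δ.hom_i.mul _ _ hx) rfl, 𝒟.mul_congr rfl (Δ.hom_i.mul _ _ hy)]
      exact 𝒟.mul_paste _ _ _ _ _ _ e1 e2)
  inv A := Δ.mkBox (right A) (ℋ.inv (bot A)) (ℋ.inv (top A)) (left A)
    (by rw [ℋ.src_inv, bot_right]) (by rw [ℋ.tgt_inv, top_left]) (by rw [ℋ.src_inv, top_right])
    (by rw [ℋ.tgt_inv, left_bot]) (by
      have e1 := box_eq A
      simp only [ij, ji, Δ.hom_i.map_inv] at e1 ⊢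
      refine 𝒟.mul_flip _ _ ?_ ?_ e1
      · rw [Δ.hom_i.src, Δ.hom_j.src]; exact top_left A
      · rw [Δ.hom_i.tgt, Δ.hom_j.tgt]; exact (bot_right A).symm)
  src_one _ := rfl
  tgt_one _ := rfl
  src_mul _ _ _ := rfl
  tgt_mul _ _ _ := rfl
  src_inv _ := rfl
  tgt_inv _ := rfl
  one_mul _ := box_ext rfl (ℋ.one_mul' _) (ℋ.one_mul' _) rfl
  mul_one _ := box_ext rfl (ℋ.mul_one' _) (ℋ.mul_one' _) rfl
  mul_assoc _ _ _ _ _ := box_ext rfl (ℋ.mul_assoc _ _ _ _ _) (ℋ.mul_assoc _ _ _ _ _) rfl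
  mul_inv A := box_ext rfl ((ℋ.mul_inv _).trans (congrArg ℋ.one (left_bot A).symm))
    ((ℋ.mul_inv _).trans (congrArg ℋ.one (top_left A))) rfl
  inv_mul A := box_ext rfl ((ℋ.inv_mul _).trans (congrArg ℋ.one (bot_right A)))
    ((ℋ.inv_mul _).trans (congrArg ℋ.one (top_right A))) rfl

/-- The vertical groupoid structure on the boxes of `□(D, j, i)`, over `H`. -/
def verGpd : Gpd H Δ.boxSet where
  src := top
  tgt := bot
  one x := Δ.mkBox (𝒱.one (ℋ.src x)) x x (𝒱.one (ℋ.tgt x)) (𝒱.tgt_one _) (𝒱.src_one _).symm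
    (𝒱.src_one _).symm (𝒱.tgt_one _).symm (by
      simp only [ij, ji, Δ.hom_j.one, id]
      rw [𝒟.one_mul', 𝒟.mul_one'])
  mul A B h := Δ.mkBox
    (𝒱.mul (left A) (left B) (by rw [left_bot, ← top_left, h])) (bot B) (top A)
    (𝒱.mul (right A) (right B) (by rw [← bot_right, ← top_right, h]))
    (by rw [𝒱.tgt_mul, left_bot]) (by rw [𝒱.src_mul, top_right]) (by rw [𝒱.src_mul, top_left])
    (by rw [𝒱.tgt_mul, bot_right]) (by
      have hf : 𝒱.tgt (left A) = 𝒱.src (left B) := by rw [left_bot, ← top_left, h]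
      have hg : 𝒱.tgt (right A) = 𝒱.src (right B) := by rw [← bot_right, ← top_right, h]
      have e1 := (box_eq A).symm
      have e2 := (box_eq B).symm
      simp only [ij, ji] at e1 e2 ⊢
      have h5 : 𝒟.tgt (Δ.i (bot A)) = 𝒟.src (Δ.j (right B)) :=
        Δ.tgt_i_eq ((congrArg ℋ.tgt h).trans (top_right B))
      rw [𝒟.mul_congr (congrArg Δ.i h.symm) rfl _ h5] at e2
      rw [𝒟.mul_congr (Δ.hom_j.mul _ _ hf) rfl, 𝒟.mul_congr rfl (Δ.hom_j.mul _ _ hg)]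
      exact (𝒟.mul_paste _ _ _ _ _ _ e1 e2).symm)
  inv A := Δ.mkBox (𝒱.inv (left A)) (top A) (bot A) (𝒱.inv (right A))
    (by rw [𝒱.tgt_inv, top_left]) (by rw [𝒱.src_inv, bot_right]) (by rw [𝒱.src_inv, left_bot])
    (by rw [𝒱.tgt_inv, top_right]) (by
      have e1 := (box_eq A).symm
      simp only [ij, ji, Δ.hom_j.map_inv] at e1 ⊢
      refine (𝒟.mul_flip _ _ ?_ ?_ e1).symm
      · rw [Δ.hom_i.src, Δ.hom_j.src]; exact (top_left A).symm
      · rw [Δ.hom_i.tgt, Δ.hom_j.tgt]; exact bot_right A)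
  src_one _ := rfl
  tgt_one _ := rfl
  src_mul _ _ _ := rfl
  tgt_mul _ _ _ := rfl
  src_inv _ := rfl
  tgt_inv _ := rfl
  one_mul A := box_ext (𝒱.one_mul' _) rfl rfl (𝒱.one_mul' _)
  mul_one A := box_ext (𝒱.mul_one' _) rfl rfl (𝒱.mul_one' _)
  mul_assoc _ _ _ _ _ := box_ext (𝒱.mul_assoc _ _ _ _ _) rfl rfl (𝒱.mul_assoc _ _ _ _ _)
  mul_inv A := box_ext ((𝒱.mul_inv _).trans (congrArg 𝒱.one (top_left A).symm)) rfl rfl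
    ((𝒱.mul_inv _).trans (congrArg 𝒱.one (top_right A).symm))
  inv_mul A := box_ext ((𝒱.inv_mul _).trans (congrArg 𝒱.one (left_bot A))) rfl rfl
    ((𝒱.inv_mul _).trans (congrArg 𝒱.one (bot_right A).symm))

/-- The double groupoid `□(D, j, i)` of a diagram of groupoids. -/
def square : DoubleGpd P V H Δ.boxSet where
  vert := 𝒱
  horiz := ℋ
  hor := Δ.horGpd
  ver := Δ.verGpd
  hor_src := ⟨fun A => (top_left A).symm, left_bot, fun _ => rfl, fun _ _ _ => rfl⟩
  hor_tgt := ⟨fun A => (top_right A).symm, fun A => (bot_right A).symm, fun _ => rfl,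
    fun _ _ _ => rfl⟩
  hor_one := ⟨fun _ => rfl, fun _ => rfl,
    fun p => box_ext (congrArg 𝒱.one (ℋ.src_one p).symm) (congrArg ℋ.one (𝒱.tgt_one p))
      (congrArg ℋ.one (𝒱.src_one p)) (congrArg 𝒱.one (ℋ.tgt_one p).symm),
    fun _ _ _ => box_ext rfl (congrArg ℋ.one (𝒱.tgt_mul _ _ _))
      (congrArg ℋ.one (𝒱.src_mul _ _ _)) rfl⟩
  hor_inv := ⟨fun _ => rfl, fun _ => rfl,
    fun x => box_ext (congrArg 𝒱.one (ℋ.src_inv x).symm) rfl rfl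
      (congrArg 𝒱.one (ℋ.tgt_inv x).symm),
    fun _ _ _ => box_ext rfl rfl rfl rfl⟩
  ver_src := ⟨top_left, top_right, fun _ => rfl, fun _ _ _ => rfl⟩
  ver_tgt := ⟨fun A => (left_bot A).symm, bot_right, fun _ => rfl, fun _ _ _ => rfl⟩
  ver_one := ⟨fun _ => rfl, fun _ => rfl,
    fun p => box_ext (congrArg 𝒱.one (ℋ.src_one p)) (congrArg ℋ.one (𝒱.tgt_one p).symm)
      (congrArg ℋ.one (𝒱.src_one p).symm) (congrArg 𝒱.one (ℋ.tgt_one p)),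
    fun _ _ _ => box_ext (congrArg 𝒱.one (ℋ.src_mul _ _ _)) rfl rfl
      (congrArg 𝒱.one (ℋ.tgt_mul _ _ _))⟩
  ver_inv := ⟨fun _ => rfl, fun _ => rfl,
    fun f => box_ext rfl (congrArg ℋ.one (𝒱.tgt_inv f).symm)
      (congrArg ℋ.one (𝒱.src_inv f).symm) rfl,
    fun _ _ _ => box_ext rfl rfl rfl rfl⟩
  interchange _ _ _ _ _ _ _ _ := box_ext rfl rfl rfl rfl

end GpdDiagram

/-! ### Lie groupoids and double Lie groupoids -/

/-- `M` is a smooth manifold of dimension `n` (without boundary): Hausdorff, second countable,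
with a smooth atlas modelled on `ℝⁿ`. -/
structure IsSmoothManifold (n : ℕ) (M : Type*) [TopologicalSpace M]
    [ChartedSpace (EuclideanSpace ℝ (Fin n)) M] : Prop where
  t2 : T2Space M
  secondCountable : SecondCountableTopology M
  isManifold : IsManifold (𝓡 n) ∞ M

/-- A smooth structure, for the subspace topology, on a subset `S` of a manifold `M`, that makes
`S` an embedded submanifold of `M`. (Such a structure is unique up to the identity
diffeomorphism, if it exists.) -/
structure SubmanifoldStructure {E K M : Type*} [NormedAddCommGroup E] [NormedSpace ℝ E]
    [TopologicalSpace K] (I : ModelWithCorners ℝ E K) [TopologicalSpace M] [ChartedSpace K M]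
    (S : Set M) where
  dim : ℕ
  chartedSpace : ChartedSpace (EuclideanSpace ℝ (Fin dim)) S
  isManifold : IsManifold (𝓡 dim) ∞ S
  isSmoothEmbedding : Manifold.IsSmoothEmbedding (𝓡 dim) I ∞ (Subtype.val : S → M)

attribute [instance] SubmanifoldStructure.chartedSpace

/-- The set of composable pairs of arrows of a groupoid. -/
def Gpd.composable {P G : Type*} (𝒢 : Gpd P G) : Set (G × G) :=
  {q | 𝒢.tgt q.1 = 𝒢.src q.2}

/-- The composition as a map on the set of composable pairs. -/
def Gpd.comp {P G : Type*} (𝒢 : Gpd P G) (q : 𝒢.composable) : G :=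
  𝒢.mul q.1.1 q.1.2 q.2

/-- A groupoid is a Lie groupoid if `P` and `G` are smooth manifolds, the source and end maps are
surjective submersions, and the other structural maps are smooth; here the set of composable pairs
is an embedded submanifold of `G × G`. -/
structure Gpd.IsLie {P G : Type*} (p g : ℕ)
    [TopologicalSpace P] [ChartedSpace (EuclideanSpace ℝ (Fin p)) P]
    [TopologicalSpace G] [ChartedSpace (EuclideanSpace ℝ (Fin g)) G] (𝒢 : Gpd P G) : Prop where
  base : IsSmoothManifold p P
  arrows : IsSmoothManifold g G
  src_surjective : Function.Surjective 𝒢.src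
  src_submersion : Manifold.IsSubmersion (𝓡 g) (𝓡 p) ∞ 𝒢.src
  tgt_surjective : Function.Surjective 𝒢.tgt
  tgt_submersion : Manifold.IsSubmersion (𝓡 g) (𝓡 p) ∞ 𝒢.tgt
  one_smooth : ContMDiff (𝓡 p) (𝓡 g) ∞ 𝒢.one
  inv_smooth : ContMDiff (𝓡 g) (𝓡 g) ∞ 𝒢.inv
  comp_smooth : ∃ A : SubmanifoldStructure ((𝓡 g).prod (𝓡 g)) 𝒢.composable,
    ContMDiff (𝓡 A.dim) (𝓡 g) ∞ 𝒢.comp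

/-- A double groupoid is a double Lie groupoid if its four groupoids are Lie groupoids and the
double source map `B → {(x, f) ∈ H × V : l(x) = t(f)}` is a surjective submersion; here the fibre
product is an embedded submanifold of `H × V`. -/
structure DoubleGpd.IsLie {P V H B : Type*} (p v h b : ℕ)
    [TopologicalSpace P] [ChartedSpace (EuclideanSpace ℝ (Fin p)) P]
    [TopologicalSpace V] [ChartedSpace (EuclideanSpace ℝ (Fin v)) V]
    [TopologicalSpace H] [ChartedSpace (EuclideanSpace ℝ (Fin h)) H]
    [TopologicalSpace B] [ChartedSpace (EuclideanSpace ℝ (Fin b)) B]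
    (ℬ : DoubleGpd P V H B) : Prop where
  vert : ℬ.vert.IsLie p v
  horiz : ℬ.horiz.IsLie p h
  hor : ℬ.hor.IsLie v b
  ver : ℬ.ver.IsLie h b
  doubleSource_surjective : Function.Surjective ℬ.doubleSource
  doubleSource_submersion :
    ∃ A : SubmanifoldStructure ((𝓡 h).prod (𝓡 v)) (cornerSet ℬ.vert ℬ.horiz),
      Manifold.IsSubmersion (𝓡 b) (𝓡 A.dim) ∞ ℬ.doubleSource

namespace GpdDiagram

section

variable {P V H D : Type*} {𝒱 : Gpd P V} {ℋ : Gpd P H} {𝒟 : Gpd P D} (Δ : GpdDiagram 𝒱 ℋ 𝒟)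

/-- The map `Φ(x, g) = i(x) j(g)` on the fibre product `{(x, g) ∈ H × V : r(x) = t(g)}`. -/
def Phi (q : {q : H × V | ℋ.tgt q.1 = 𝒱.src q.2}) : D := Δ.ij q.1.1 q.1.2 q.2

/-- The map `Ψ(f, y) = j(f) i(y)` on the fibre product `{(f, y) ∈ V × H : b(f) = l(y)}`. -/
def Psi (q : {q : V × H | 𝒱.tgt q.1 = ℋ.src q.2}) : D := Δ.ji q.1.1 q.1.2 q.2

end

section

variable {P V H D : Type*} (p v h d : ℕ)
  [TopologicalSpace P] [ChartedSpace (EuclideanSpace ℝ (Fin p)) P]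
  [TopologicalSpace V] [ChartedSpace (EuclideanSpace ℝ (Fin v)) V]
  [TopologicalSpace H] [ChartedSpace (EuclideanSpace ℝ (Fin h)) H]
  [TopologicalSpace D] [ChartedSpace (EuclideanSpace ℝ (Fin d)) D]
  {𝒱 : Gpd P V} {ℋ : Gpd P H} {𝒟 : Gpd P D} (Δ : GpdDiagram 𝒱 ℋ 𝒟)

/-- A diagram of Lie groupoids: the three groupoids are Lie groupoids, and `i`, `j` are smooth. -/
structure IsLie : Prop where
  vert : 𝒱.IsLie p v
  horiz : ℋ.IsLie p h
  diag : 𝒟.IsLie p d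
  i_smooth : ContMDiff (𝓡 h) (𝓡 d) ∞ Δ.i
  j_smooth : ContMDiff (𝓡 v) (𝓡 d) ∞ Δ.j

end

end GpdDiagram

/-- The differential of `f : M → Q` at `m`, as a linear map `ℝᵃ → ℝᵈ`: the tangent spaces
`T_m M` and `T_{f m} Q` are the model spaces, through the preferred charts at `m` and `f m`. -/
noncomputable def differential {M Q : Type*} (a d : ℕ)
    [TopologicalSpace M] [ChartedSpace (EuclideanSpace ℝ (Fin a)) M]
    [TopologicalSpace Q] [ChartedSpace (EuclideanSpace ℝ (Fin d)) Q]
    (f : M → Q) (m : M) : EuclideanSpace ℝ (Fin a) →L[ℝ] EuclideanSpace ℝ (Fin d) :=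
  mfderiv (𝓡 a) (𝓡 d) f m

/-- Smooth maps `f : M → Q` and `g : N → Q` with `f m = g n` are transversal at this point if the
images of their differentials at `m` and `n` span the tangent space of `Q` at `f m = g n`. -/
def TransversalAt {M N Q : Type*} (a b d : ℕ)
    [TopologicalSpace M] [ChartedSpace (EuclideanSpace ℝ (Fin a)) M]
    [TopologicalSpace N] [ChartedSpace (EuclideanSpace ℝ (Fin b)) N]
    [TopologicalSpace Q] [ChartedSpace (EuclideanSpace ℝ (Fin d)) Q]
    (f : M → Q) (g : N → Q) (m : M) (n : N) (_h : f m = g n) : Prop :=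
  (differential a d f m).range ⊔ (differential b d g n).range = ⊤

/-- The maps `i` and `j` of a diagram of Lie groupoids are transversal at the identities. -/
def GpdDiagram.TransversalAtIdentities {P V H D : Type*} (v h d : ℕ)
    [TopologicalSpace V] [ChartedSpace (EuclideanSpace ℝ (Fin v)) V]
    [TopologicalSpace H] [ChartedSpace (EuclideanSpace ℝ (Fin h)) H]
    [TopologicalSpace D] [ChartedSpace (EuclideanSpace ℝ (Fin d)) D]
    {𝒱 : Gpd P V} {ℋ : Gpd P H} {𝒟 : Gpd P D} (Δ : GpdDiagram 𝒱 ℋ 𝒟) : Prop :=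
  ∀ p : P, TransversalAt h v d Δ.i Δ.j (ℋ.one p) (𝒱.one p)
    ((Δ.hom_i.one p).trans (Δ.hom_j.one p).symm)

/-! Submersions are handled as smooth maps with a smooth local section through every point, and
immersions through smooth local retractions. Both conditions compose easily, and the inverse
function theorem links them to the normal forms in charts
(`ContMDiff.isSubmersion_of_hasLocalSectionAt`,
`ContMDiff.isImmersionAtOfComplement_of_retraction`). Fibre products of a submersion with a smooth
map then receive explicit local parametrizations, which make them embedded submanifolds.

Transversality makes `Φ` a submersion at each pair of identities, and translation spreads this
everywhere. Near `d₀ = i(x₀) j(g₀)` take local sections `X` of `l` through `x₀` and `Y` of `b`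
through `g₀`. The arrow `δ(c) = i(X)⁻¹ c j(Y)⁻¹` is the identity at `r(x₀)` when `c = d₀`, so for
`c` near `d₀` it is `i(ξ) j(γ)` with `(ξ, γ)` depending smoothly on `c`. Then `(X ξ, γ Y)` is a
local section of `Φ` through `(x₀, g₀)` (`IsLie.hasLocalSectionAt_Phi`). Exchanging `H` and `V`
gives `Ψ`.

The boxes form the fibre product of `Ψ` and `Φ` over `D`, hence a submanifold. To complete a corner
`(x, f)` to a box is to factor `i(x)⁻¹ j(f) = j(g) i(y)`: the right side is `g` and the bottom side
`y⁻¹`. Local sections of `Ψ` therefore give local sections of the double source map, while the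
factorization hypothesis serves only for its surjectivity. The source maps of the two box groupoids
are the double source followed by a projection, and their other structure maps are smooth side by
side. -/

/-! ### Inverse function theorem and change of charts. -/

open Set Topology in
/-- The inverse function theorem, as a local diffeomorphism that is smooth in both directions. -/
theorem exists_openPartialHomeomorph_of_hasFDerivAt {E E' : Type*}
    [NormedAddCommGroup E] [NormedSpace ℝ E] [CompleteSpace E]
    [NormedAddCommGroup E'] [NormedSpace ℝ E']
    {G : E → E'} {U : Set E} (hU : IsOpen U) (hG : ContDiffOn ℝ ∞ G U) {a : E} (ha : a ∈ U)
    (A : E ≃L[ℝ] E') (hA : HasFDerivAt G (A : E →L[ℝ] E') a) :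
    ∃ e : OpenPartialHomeomorph E E', a ∈ e.source ∧ e.source ⊆ U ∧ (e : E → E') = G ∧
      ContDiffOn ℝ ∞ e e.source ∧ ContDiffOn ℝ ∞ e.symm e.target := by
  have hGa : ContDiffAt ℝ ∞ G a := hG.contDiffAt (hU.mem_nhds ha)
  set e₀ := hGa.toOpenPartialHomeomorph G hA (by simp) with he₀
  -- Smoothness of the inverse is wanted on the whole target, so the source is cut down to the
  -- points where the derivative is invertible. These form an open set because invertible operators
  -- are open.
  set W : Set E := U ∩ fderiv ℝ G ⁻¹' range ((↑) : (E ≃L[ℝ] E') → E →L[ℝ] E') with hW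
  have hWo : IsOpen W :=
    (hG.continuousOn_fderiv_of_isOpen hU (by simp)).isOpen_inter_preimage hU
      ContinuousLinearEquiv.isOpen
  have haW : a ∈ W := ⟨ha, A, hA.fderiv.symm⟩
  have hsrc : (e₀.restrOpen W hWo).source ⊆ W := fun x hx => by
    rw [OpenPartialHomeomorph.restrOpen_source] at hx; exact hx.2
  refine ⟨e₀.restrOpen W hWo, ?_, fun x hx => (hsrc hx).1, rfl,
    hG.mono fun x hx => (hsrc hx).1, ?_⟩
  · rw [OpenPartialHomeomorph.restrOpen_source]
    exact ⟨hGa.mem_toOpenPartialHomeomorph_source hA (by simp), haW⟩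
  · intro y hy
    have hx := hsrc ((e₀.restrOpen W hWo).map_target hy)
    obtain ⟨B, hB⟩ := hx.2
    refine ((e₀.restrOpen W hWo).contDiffAt_symm (f₀' := B) hy ?_ ?_).contDiffWithinAt
    · rw [hB]
      exact ((hG.contDiffAt (hU.mem_nhds hx.1)).differentiableAt (by simp)).hasFDerivAt
    · exact hG.contDiffAt (hU.mem_nhds hx.1)

section Charts

open Set Topology

variable {E K M : Type*} [NormedAddCommGroup E] [NormedSpace ℝ E] [TopologicalSpace K]
  {I : ModelWithCorners ℝ E K} [I.Boundaryless] [TopologicalSpace M] [ChartedSpace K M]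
  [IsManifold I ∞ M]

/-- Composing a chart with a local diffeomorphism of the model vector space gives a chart. -/
theorem exists_chart_comp {φ : OpenPartialHomeomorph M K}
    (hφ : φ ∈ IsManifold.maximalAtlas I ∞ M) {x : M} (hx : x ∈ φ.source)
    (e : OpenPartialHomeomorph E E) (he : ContDiffOn ℝ ∞ e e.source)
    (he' : ContDiffOn ℝ ∞ e.symm e.target) (hxe : φ.extend I x ∈ e.source) :
    ∃ φ' ∈ IsManifold.maximalAtlas I ∞ M, x ∈ φ'.source ∧ φ'.source ⊆ φ.source ∧
      (∀ y, φ'.extend I y = e (φ.extend I y)) ∧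
      ∀ w ∈ (φ'.extend I).target, w ∈ e.target ∧ e.symm w ∈ (φ.extend I).target ∧
        (φ'.extend I).symm w = (φ.extend I).symm (e.symm w) := by
  -- Without boundary, `I` is a homeomorphism from `K` onto `E`; `k` is `e` conjugated by it.
  set k : OpenPartialHomeomorph K K := I.toHomeomorph.toOpenPartialHomeomorph ≫ₕ e ≫ₕ
    I.toHomeomorph.symm.toOpenPartialHomeomorph with hk
  have hr : ∀ w : E, I (I.symm w) = w := fun w => I.right_inv (by simp [I.range_eq_univ])
  have hka : ∀ z, k z = I.symm (e (I z)) := fun z => rfl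
  have hks : ∀ z, k.symm z = I.symm (e.symm (I z)) := fun z => rfl
  have hksrc : k.source = I ⁻¹' e.source := by ext z; simp [hk]
  have hktgt : k.target = I ⁻¹' e.target := by
    ext z; simp [hk]
  have smooth : ∀ (g : E → E) (s : Set E), ContDiffOn ℝ ∞ g s →
      ContMDiffOn I I ∞ (fun z => I.symm (g (I z))) (I ⁻¹' s) := fun g s hg =>
    (I.contMDiffOn_symm.comp ((contMDiffOn_iff_contDiffOn.mpr hg).comp I.contMDiff.contMDiffOn
      (fun _ hz => hz)) fun z _ => by simp [I.range_eq_univ])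
  refine ⟨φ ≫ₕ k, OpenPartialHomeomorph.mem_maximalAtlas_of_contMDiffOn _ ?_ ?_, ?_, ?_, ?_, ?_⟩
  · rw [OpenPartialHomeomorph.trans_source, hksrc]
    exact (smooth e _ he).comp ((contMDiffOn_of_mem_maximalAtlas hφ).mono inter_subset_left)
      fun y hy => hy.2
  · rw [OpenPartialHomeomorph.trans_target, hktgt]
    exact (contMDiffOn_symm_of_mem_maximalAtlas hφ).comp
      ((smooth e.symm _ he').mono inter_subset_left) fun y hy => hy.2
  · rw [OpenPartialHomeomorph.trans_source, hksrc]; exact ⟨hx, hxe⟩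
  · rw [OpenPartialHomeomorph.trans_source]; exact inter_subset_left
  · intro y
    simp [hka, hr]
  · intro w hw
    simp only [OpenPartialHomeomorph.extend_target, OpenPartialHomeomorph.trans_target, hktgt,
      mem_inter_iff, mem_preimage, hks, hr] at hw
    refine ⟨hw.1.1, ?_, ?_⟩
    · rw [OpenPartialHomeomorph.extend_target]
      exact ⟨hw.1.2, by simp [I.range_eq_univ]⟩
    · simp [hks, hr]

end Charts

/-! ### Linear normal forms and straightening of smooth maps. -/

open Module in
-- Pair `A` with a linear retraction onto its kernel. A vector killed by both lies in the kernel and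
-- equals its own retraction, hence vanishes; equality of dimensions does the rest.
theorem ContinuousLinearMap.exists_equiv_prod_of_surjective {E E' : Type*} [NormedAddCommGroup E]
    [NormedSpace ℝ E] [FiniteDimensional ℝ E] [NormedAddCommGroup E'] [NormedSpace ℝ E']
    [FiniteDimensional ℝ E'] (A : E →L[ℝ] E') (hA : Function.Surjective A) :
    ∃ L : E ≃L[ℝ] E' × EuclideanSpace ℝ (Fin (finrank ℝ E - finrank ℝ E')),
      ∀ u, (L u).1 = A u := by
  have hk : finrank ℝ E' + finrank ℝ A.toLinearMap.ker = finrank ℝ E := by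
    rw [← A.toLinearMap.finrank_range_add_finrank_ker, LinearMap.range_eq_top.mpr hA, finrank_top]
  obtain ⟨π, hπ⟩ := A.toLinearMap.ker.subtype.exists_leftInverse_of_injective
    (Submodule.ker_subtype _)
  have κ : A.toLinearMap.ker ≃ₗ[ℝ] EuclideanSpace ℝ (Fin (finrank ℝ E - finrank ℝ E')) :=
    LinearEquiv.ofFinrankEq _ _ (by rw [finrank_euclideanSpace_fin]; omega)
  have hinj : Function.Injective (A.toLinearMap.prod (κ.toLinearMap ∘ₗ π)) := by
    rw [← LinearMap.ker_eq_bot, LinearMap.ker_eq_bot']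
    intro u hu
    have hu1 : A u = 0 := congrArg Prod.fst hu
    have hu2 : π u = 0 := (map_eq_zero_iff κ κ.injective).mp (congrArg Prod.snd hu)
    have h1 := LinearMap.congr_fun hπ ⟨u, hu1⟩
    simp only [LinearMap.comp_apply, Submodule.subtype_apply, LinearMap.id_apply, hu2] at h1
    exact (congrArg Subtype.val h1).symm
  refine ⟨(LinearMap.linearEquivOfInjective _ hinj ?_).toContinuousLinearEquiv, fun u => rfl⟩
  rw [finrank_prod, finrank_euclideanSpace_fin]; omega

open Module in
-- The second factor is sent isomorphically onto a complement of the range of `A`.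
theorem ContinuousLinearMap.exists_equiv_prod_of_injective {E E' : Type*} [NormedAddCommGroup E]
    [NormedSpace ℝ E] [FiniteDimensional ℝ E] [NormedAddCommGroup E'] [NormedSpace ℝ E']
    [FiniteDimensional ℝ E'] (A : E →L[ℝ] E') (hA : Function.Injective A) :
    ∃ L : (E × EuclideanSpace ℝ (Fin (finrank ℝ E' - finrank ℝ E))) ≃L[ℝ] E',
      ∀ u, L (u, 0) = A u := by
  have hr : finrank ℝ A.toLinearMap.range = finrank ℝ E := LinearMap.finrank_range_of_inj hA
  obtain ⟨q, hq⟩ := A.toLinearMap.range.exists_isCompl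
  have hqr := Submodule.finrank_add_eq_of_isCompl hq
  have κ : EuclideanSpace ℝ (Fin (finrank ℝ E' - finrank ℝ E)) ≃ₗ[ℝ] q :=
    LinearEquiv.ofFinrankEq _ _ (by rw [finrank_euclideanSpace_fin]; omega)
  have hinj : Function.Injective (A.toLinearMap.coprod (q.subtype ∘ₗ κ.toLinearMap)) := by
    rw [← LinearMap.ker_eq_bot, LinearMap.ker_eq_bot']
    rintro ⟨u, w⟩ hu
    simp only [LinearMap.coprod_apply, LinearMap.comp_apply, Submodule.subtype_apply,
      LinearEquiv.coe_coe] at hu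
    have h0 : A.toLinearMap u = 0 := by
      refine Submodule.disjoint_def.mp hq.disjoint _ ⟨u, rfl⟩ ?_
      rw [eq_neg_of_add_eq_zero_left hu]
      exact q.neg_mem (κ w).2
    rw [h0, zero_add, ZeroMemClass.coe_eq_zero, EmbeddingLike.map_eq_zero_iff] at hu
    have h1 : u = 0 := hA (by rw [map_zero]; exact h0)
    rw [hu, h1]; rfl
  refine ⟨(LinearMap.linearEquivOfInjective _ hinj ?_).toContinuousLinearEquiv, fun u => ?_⟩
  · rw [finrank_prod, finrank_euclideanSpace_fin]; omega
  · simp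

/-- Replacing the first `L`-coordinate by `g` changes nothing to first order at `a`. The resulting
map has the identity as derivative there, so it is a local diffeomorphism. -/
theorem exists_openPartialHomeomorph_straighten_fst {E E' F : Type*}
    [NormedAddCommGroup E] [NormedSpace ℝ E] [CompleteSpace E]
    [NormedAddCommGroup E'] [NormedSpace ℝ E'] [NormedAddCommGroup F] [NormedSpace ℝ F]
    {g : E → E'} {U : Set E} (hU : IsOpen U) (hg : ContDiffOn ℝ ∞ g U) {a : E} (ha : a ∈ U)
    {A : E →L[ℝ] E'} (hA : HasFDerivAt g A a) (L : E ≃L[ℝ] E' × F) (hL : ∀ u, (L u).1 = A u) :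
    ∃ e : OpenPartialHomeomorph E E, a ∈ e.source ∧ ContDiffOn ℝ ∞ e e.source ∧
      ContDiffOn ℝ ∞ e.symm e.target ∧ ∀ u, (L (e u)).1 = g u := by
  set G : E → E := fun u => L.symm (g u, (L u).2) with hG
  have hGs : ContDiffOn ℝ ∞ G U := L.symm.contDiff.comp_contDiffOn
    (hg.prodMk (contDiff_snd.comp L.contDiff).contDiffOn)
  have hGd : HasFDerivAt G ((ContinuousLinearEquiv.refl ℝ E : E ≃L[ℝ] E) : E →L[ℝ] E) a := by
    have h1 := L.symm.hasFDerivAt.comp a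
      (hA.prodMk (((ContinuousLinearMap.snd ℝ _ _).hasFDerivAt).comp _ L.hasFDerivAt))
    refine h1.congr_fderiv ?_
    ext u
    simp only [ContinuousLinearMap.comp_apply, ContinuousLinearEquiv.coe_coe,
      ContinuousLinearEquiv.coe_refl, ContinuousLinearMap.id_apply]
    rw [ContinuousLinearEquiv.symm_apply_eq]
    exact Prod.ext (hL u).symm rfl
  obtain ⟨e, hxe, -, heG, hes, hes'⟩ :=
    exists_openPartialHomeomorph_of_hasFDerivAt hU hGs ha _ hGd
  exact ⟨e, hxe, hes, hes', fun u => by simp [heG, hG]⟩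

/-- Thicken `g` along the complement by `L (u, w) ↦ g u + L (0, w)`; the derivative at `L (a, 0)` is
the identity. -/
theorem exists_openPartialHomeomorph_straighten_inl {E E' F : Type*}
    [NormedAddCommGroup E] [NormedSpace ℝ E] [NormedAddCommGroup E'] [NormedSpace ℝ E']
    [CompleteSpace E'] [NormedAddCommGroup F] [NormedSpace ℝ F]
    {g : E → E'} {U : Set E} (hU : IsOpen U) (hg : ContDiffOn ℝ ∞ g U) {a : E} (ha : a ∈ U)
    {A : E →L[ℝ] E'} (hA : HasFDerivAt g A a) (L : (E × F) ≃L[ℝ] E') (hL : ∀ u, L (u, 0) = A u) :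
    ∃ e : OpenPartialHomeomorph E' E', L (a, 0) ∈ e.source ∧ ContDiffOn ℝ ∞ e e.source ∧
      ContDiffOn ℝ ∞ e.symm e.target ∧ ∀ u, e (L (u, 0)) = g u := by
  set G : E' → E' := fun u => g (L.symm u).1 + L (0, (L.symm u).2) with hG
  set V : Set E' := (fun u => (L.symm u).1) ⁻¹' U with hV
  have hVo : IsOpen V := hU.preimage (continuous_fst.comp L.symm.continuous)
  have haV : L (a, 0) ∈ V := by simpa [hV] using ha
  have hGs : ContDiffOn ℝ ∞ G V :=
    (hg.comp (contDiff_fst.comp L.symm.contDiff).contDiffOn fun u hu => hu).add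
      (L.contDiff.comp (contDiff_const.prodMk (contDiff_snd.comp L.symm.contDiff))).contDiffOn
  have hGd : HasFDerivAt G ((ContinuousLinearEquiv.refl ℝ E' : E' ≃L[ℝ] E') : E' →L[ℝ] E')
      (L (a, 0)) := by
    have hA' : HasFDerivAt g A ((L.symm (L (a, 0))).1) := by simpa using hA
    have h1 := (hA'.comp (L (a, 0))
      (((ContinuousLinearMap.fst ℝ _ _).hasFDerivAt).comp _ L.symm.hasFDerivAt)).add
      ((L.hasFDerivAt).comp (L (a, 0)) ((hasFDerivAt_const (0 : E) (L (a, 0))).prodMk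
        (((ContinuousLinearMap.snd ℝ _ _).hasFDerivAt).comp _ L.symm.hasFDerivAt)))
    refine h1.congr_fderiv ?_
    ext u
    simp only [ContinuousLinearMap.comp_apply, add_apply, ContinuousLinearEquiv.coe_coe,
      ContinuousLinearEquiv.coe_refl, ContinuousLinearMap.id_apply]
    rw [← hL, ← L.map_add]
    conv_rhs => rw [← L.apply_symm_apply u]
    congr 1
    ext <;> simp
  obtain ⟨e, hxe, -, heG, hes, hes'⟩ :=
    exists_openPartialHomeomorph_of_hasFDerivAt hVo hGs haV _ hGd
  exact ⟨e, hxe, hes, hes', fun u => by simp [heG, hG]⟩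

/-! ### Submersions and immersions from the rank of the differential. -/

section NormalForms

open Set Topology Module Manifold

variable {E E' K K' M N : Type*} [NormedAddCommGroup E] [NormedSpace ℝ E]
  [NormedAddCommGroup E'] [NormedSpace ℝ E'] [TopologicalSpace K] [TopologicalSpace K']
  {I : ModelWithCorners ℝ E K} {J : ModelWithCorners ℝ E' K'}
  [TopologicalSpace M] [ChartedSpace K M] [TopologicalSpace N] [ChartedSpace K' N]

variable (I J) in
/-- The differential of a map between manifolds, as a map between the model vector spaces. -/
noncomputable def modelDeriv (f : M → N) (x : M) : E →L[ℝ] E' := mfderiv I J f x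

variable [I.Boundaryless] [IsManifold I ∞ M] [IsManifold J ∞ N]

/-- A smooth map read in charts: an open set on which it is smooth, and its derivative. -/
theorem ContMDiff.writtenInExtChartAt_smooth {f : M → N} (hf : ContMDiff I J ∞ f) (x : M) :
    ∃ U : Set E, IsOpen U ∧ extChartAt I x x ∈ U ∧
      ContDiffOn ℝ ∞ (writtenInExtChartAt I J x f) U ∧
      HasFDerivAt (writtenInExtChartAt I J x f)
        (modelDeriv I J f x) (extChartAt I x x) := by
  refine ⟨(extChartAt I x).target ∩ (extChartAt I x).symm ⁻¹'
    (f ⁻¹' (extChartAt J (f x)).source), ?_, ?_, ?_, ?_⟩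
  · exact (continuousOn_extChartAt_symm x).isOpen_inter_preimage (isOpen_extChartAt_target x)
      ((isOpen_extChartAt_source (f x)).preimage hf.continuous)
  · exact ⟨mem_extChartAt_target x, by simp⟩
  · exact (contMDiff_iff.mp hf).2 x (f x)
  · have h : HasFDerivWithinAt (writtenInExtChartAt I J x f) (modelDeriv I J f x) (range I)
      (extChartAt I x x) := ((hf x).mdifferentiableAt (by simp)).hasMFDerivAt.2
    rwa [I.range_eq_univ, hasFDerivWithinAt_univ] at h

variable [FiniteDimensional ℝ E] [FiniteDimensional ℝ E']

/-- A smooth map with surjective differential at `x` is a submersion at `x`. -/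
theorem ContMDiff.isSubmersionAtOfComplement {f : M → N} (hf : ContMDiff I J ∞ f) {x : M}
    (hs : Function.Surjective (modelDeriv I J f x)) :
    IsSubmersionAtOfComplement (EuclideanSpace ℝ (Fin (finrank ℝ E - finrank ℝ E'))) I J ∞ f x := by
  obtain ⟨U, hU, hxU, hsm, hder⟩ := hf.writtenInExtChartAt_smooth x
  obtain ⟨L, hL⟩ := ContinuousLinearMap.exists_equiv_prod_of_surjective _ hs
  obtain ⟨e, hxe, hes, hes', heL⟩ :=
    exists_openPartialHomeomorph_straighten_fst hU hsm hxU hder L hL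
  obtain ⟨φ, hφ, hxφ, -, -, hφt⟩ := exists_chart_comp
    (IsManifold.chart_mem_maximalAtlas (I := I) (n := ∞) x) (mem_chart_source K x) e hes hes' hxe
  refine IsSubmersionAtOfComplement.mk_of_continuousAt hf.continuous.continuousAt L φ
    (chartAt K' (f x)) hxφ (mem_chart_source _ _) hφ (IsManifold.chart_mem_maximalAtlas _) ?_
  intro w hw
  obtain ⟨hwe, -, hw2⟩ := hφt w hw
  have h2 := heL (e.symm w)
  rw [e.right_inv hwe] at h2
  rw [Function.comp_apply, Function.comp_apply, hw2, Function.comp_apply, h2]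
  rfl

/-- A smooth map with injective differential at `x` is an immersion at `x`. -/
theorem ContMDiff.isImmersionAtOfComplement [J.Boundaryless] {f : M → N}
    (hf : ContMDiff I J ∞ f) {x : M}
    (hs : Function.Injective (modelDeriv I J f x)) :
    IsImmersionAtOfComplement (EuclideanSpace ℝ (Fin (finrank ℝ E' - finrank ℝ E))) I J ∞ f x := by
  obtain ⟨U, hU, hxU, hsm, hder⟩ := hf.writtenInExtChartAt_smooth x
  obtain ⟨L, hL⟩ := ContinuousLinearMap.exists_equiv_prod_of_injective _ hs
  obtain ⟨e, hxe, hes, hes', heL⟩ :=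
    exists_openPartialHomeomorph_straighten_inl hU hsm hxU hder L hL
  have hxe' : extChartAt J (f x) (f x) ∈ e.target := by
    have h1 := heL (extChartAt I x x)
    rw [show writtenInExtChartAt I J x f (extChartAt I x x) = extChartAt J (f x) (f x) by
      rw [writtenInExtChartAt, Function.comp_apply, Function.comp_apply, extChartAt_to_inv]] at h1
    exact h1 ▸ e.map_source hxe
  obtain ⟨φ, hφ, hxφ, -, hφe, -⟩ := exists_chart_comp
    (IsManifold.chart_mem_maximalAtlas (I := J) (n := ∞) (f x)) (mem_chart_source K' (f x)) e.symm
    hes' (by rw [e.symm_symm]; exact hes) hxe'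
  -- The chart on the target is followed by `e.symm`, which undoes `e` only on `e.source`; the chart
  -- on `M` is shrunk until all points `L (u, 0)` lie there.
  set O : Set M := (chartAt K x).source ∩ extChartAt I x ⁻¹' ((fun u => L (u, 0)) ⁻¹' e.source)
    with hO
  have hOo : IsOpen O := by
    rw [hO, ← extChartAt_source I]
    exact (continuousOn_extChartAt x).isOpen_inter_preimage (isOpen_extChartAt_source x)
      (e.open_source.preimage (L.continuous.comp (by fun_prop)))
  have hxO : x ∈ O := ⟨mem_chart_source _ _, hxe⟩
  refine IsImmersionAtOfComplement.mk_of_continuousAt hf.continuous.continuousAt L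
    ((chartAt K x).restr O) φ ?_ hxφ
    (restr_mem_maximalAtlas _ (IsManifold.chart_mem_maximalAtlas x) hOo) hφ ?_
  · rw [OpenPartialHomeomorph.restr_source, hOo.interior_eq]; exact ⟨mem_chart_source _ _, hxO⟩
  intro w hw
  have h4 := (((chartAt K x).restr O).extend I).map_target hw
  rw [OpenPartialHomeomorph.extend_source, OpenPartialHomeomorph.restr_source,
    hOo.interior_eq] at h4
  have h5 : extChartAt I x ((extChartAt I x).symm w) = w :=
    (((chartAt K x).restr O).extend I).right_inv hw
  have h6 : L (extChartAt I x ((extChartAt I x).symm w), 0) ∈ e.source := h4.2.2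
  rw [h5] at h6
  have h7 : φ.extend J (f ((extChartAt I x).symm w)) =
      e.symm (writtenInExtChartAt I J x f w) := hφe _
  rw [← heL, e.left_inv h6] at h7
  exact h7

end NormalForms

/-! ### Local sections and local retractions. -/

section LocalSections

open Set Topology Module Manifold Filter

variable {E E' E'' K K' K'' M N Q : Type*} [NormedAddCommGroup E] [NormedSpace ℝ E]
  [NormedAddCommGroup E'] [NormedSpace ℝ E'] [NormedAddCommGroup E''] [NormedSpace ℝ E'']
  [TopologicalSpace K] [TopologicalSpace K'] [TopologicalSpace K'']
  {I : ModelWithCorners ℝ E K} {J : ModelWithCorners ℝ E' K'} {J' : ModelWithCorners ℝ E'' K''}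
  [TopologicalSpace M] [ChartedSpace K M] [TopologicalSpace N] [ChartedSpace K' N]
  [TopologicalSpace Q] [ChartedSpace K'' Q]

theorem modelDeriv_comp {g : N → Q} {f : M → N} {x : M} (hg : MDifferentiableAt J J' g (f x))
    (hf : MDifferentiableAt I J f x) :
    modelDeriv I J' (g ∘ f) x = (modelDeriv J J' g (f x)).comp (modelDeriv I J f x) :=
  mfderiv_comp x hg hf

theorem modelDeriv_eq_id {f : M → M} {x : M} (h : ∀ᶠ y in 𝓝 x, f y = y) :
    modelDeriv I I f x = ContinuousLinearMap.id ℝ E := by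
  have h1 : f =ᶠ[𝓝 x] id := h
  exact h1.mfderiv_eq.trans mfderiv_id

variable (I J) in
/-- The map `f` has a smooth local section through `x`. -/
def HasLocalSectionAt (f : M → N) (x : M) : Prop :=
  ∃ σ : N → M, σ (f x) = x ∧ ContMDiffAt J I ∞ σ (f x) ∧ ∀ᶠ y in 𝓝 (f x), f (σ y) = y

theorem HasLocalSectionAt.comp {g : N → Q} {f : M → N} {x : M}
    (hg : HasLocalSectionAt J J' g (f x)) (hf : HasLocalSectionAt I J f x) :
    HasLocalSectionAt I J' (g ∘ f) x := by
  obtain ⟨σ, h1, h2, h3⟩ := hf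
  obtain ⟨τ, k1, k2, k3⟩ := hg
  refine ⟨σ ∘ τ, ?_, ?_, ?_⟩
  · simp [k1, h1]
  · exact ContMDiffAt.comp _ (by rw [Function.comp_apply, k1]; exact h2) k2
  · have h4 : Tendsto τ (𝓝 (g (f x))) (𝓝 (f x)) := by
      have := k2.continuousAt.tendsto
      rwa [k1] at this
    filter_upwards [k3, h4.eventually h3] with y hy hy'
    simp [hy', hy]

/-- By the chain rule, the differential of the section is a right inverse. -/
theorem HasLocalSectionAt.surjective_modelDeriv {f : M → N} {x : M}
    (h : HasLocalSectionAt I J f x) (hf : MDifferentiableAt I J f x) :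
    Function.Surjective (modelDeriv I J f x) := by
  obtain ⟨σ, h1, h2, h3⟩ := h
  have h4 := modelDeriv_comp (I := J) (J := I) (J' := J) (f := σ) (x := f x) (g := f)
    (by rwa [h1]) (h2.mdifferentiableAt (by simp))
  rw [modelDeriv_eq_id (f := f ∘ σ) h3, h1] at h4
  intro v
  exact ⟨_, (congrArg (fun A => A v) h4).symm⟩

/-- In adapted charts `f` is a linear projection; the section freezes the fibre coordinate at its
value at `x`. -/
theorem Manifold.IsSubmersionAtOfComplement.hasLocalSectionAt {F : Type*} [NormedAddCommGroup F]
    [NormedSpace ℝ F] [I.Boundaryless] {f : M → N} {x : M}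
    (h : IsSubmersionAtOfComplement F I J ∞ f x) : HasLocalSectionAt I J f x := by
  set φ := h.domChart.extend I with hφ
  set ψ := h.codChart.extend J with hψ
  have hxφ : x ∈ φ.source := by
    rw [hφ, OpenPartialHomeomorph.extend_source]; exact h.mem_domChart_source
  have hfxψ : f x ∈ ψ.source := by
    rw [hψ, OpenPartialHomeomorph.extend_source]; exact h.mem_codChart_source
  have key : ∀ u ∈ φ.target, ψ (f (φ.symm u)) = (h.equiv u).1 := h.writtenInCharts
  have hto : IsOpen φ.target := h.domChart.isOpen_extend_target
  have hmap : ∀ u ∈ φ.target, f (φ.symm u) ∈ ψ.source := fun u hu => by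
    rw [hψ, OpenPartialHomeomorph.extend_source]
    refine h.mapsto_domChart_source_codChart_source ?_
    rw [← OpenPartialHomeomorph.extend_source (I := I)]
    exact φ.map_target hu
  set s : N → E := fun y => h.equiv.symm (ψ y, (h.equiv (φ x)).2) with hs
  have hsx : s (f x) = φ x := by
    have h1 := key _ (φ.map_source hxφ)
    rw [φ.left_inv hxφ] at h1
    simp [hs, h1]
  have hsc : ContMDiffAt J 𝓘(ℝ, E) ∞ s (f x) :=
    h.equiv.symm.contDiff.contMDiff.contMDiffAt.comp _
      ((h.codChart.contMDiffAt_extend h.codChart_mem_maximalAtlas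
        h.mem_codChart_source).prodMk_space contMDiffAt_const)
  have hst : ∀ᶠ y in 𝓝 (f x), s y ∈ φ.target :=
    hsc.continuousAt.eventually (by rw [hsx]; exact hto.mem_nhds (φ.map_source hxφ))
  refine ⟨fun y => φ.symm (s y), ?_, ?_, ?_⟩
  · simp only [hsx, φ.left_inv hxφ]
  · refine ContMDiffAt.comp _ (I' := 𝓘(ℝ, E)) ?_ hsc
    refine (contMDiffOn_extend_symm h.domChart_mem_maximalAtlas).contMDiffAt ?_
    rw [hsx]
    have : I '' h.domChart.target = φ.target := by
      rw [hφ, OpenPartialHomeomorph.extend_target, I.range_eq_univ, inter_univ, I.image_eq,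
        I.range_eq_univ, inter_univ]
    rw [this]
    exact hto.mem_nhds (φ.map_source hxφ)
  · have hsrc : ∀ᶠ y in 𝓝 (f x), y ∈ ψ.source := by
      rw [hψ, OpenPartialHomeomorph.extend_source]
      exact h.codChart.open_source.mem_nhds h.mem_codChart_source
    filter_upwards [hst, hsrc] with y hy hy'
    refine ψ.injOn (hmap _ hy) hy' ?_
    rw [key _ hy]
    simp [hs]

/-- A smooth map with smooth local sections through all points is a submersion. -/
theorem ContMDiff.isSubmersion_of_hasLocalSectionAt [I.Boundaryless]
    [IsManifold I ∞ M] [IsManifold J ∞ N] [FiniteDimensional ℝ E] [FiniteDimensional ℝ E']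
    {f : M → N} (hf : ContMDiff I J ∞ f) (h : ∀ x, HasLocalSectionAt I J f x) :
    IsSubmersion I J ∞ f :=
  IsSubmersionOfComplement.isSubmersion fun x => hf.isSubmersionAtOfComplement
    ((h x).surjective_modelDeriv ((hf x).mdifferentiableAt (by simp)))

theorem Manifold.IsSubmersion.hasLocalSectionAt [I.Boundaryless] {f : M → N}
    (h : IsSubmersion I J ∞ f) (x : M) : HasLocalSectionAt I J f x :=
  (h.isSubmersionOfComplement_complement x).hasLocalSectionAt

/-- An immersion has smooth local retractions. -/
theorem Manifold.IsImmersionAtOfComplement.exists_retraction {F : Type*} [NormedAddCommGroup F]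
    [NormedSpace ℝ F] [I.Boundaryless] {f : M → N} {x : M}
    (h : IsImmersionAtOfComplement F I J ∞ f x) :
    ∃ (R : N → M) (U : Set N), IsOpen U ∧ f x ∈ U ∧ ContMDiffOn J I ∞ R U ∧
      ∀ᶠ y in 𝓝 x, R (f y) = y := by
  -- In adapted charts `f` is `u ↦ (u, 0)`, and the retraction forgets the second coordinate.
  set φ := h.domChart.extend I with hφ
  set ψ := h.codChart.extend J with hψ
  have hxφ : x ∈ φ.source := by
    rw [hφ, OpenPartialHomeomorph.extend_source]; exact h.mem_domChart_source
  have key : ∀ y ∈ φ.source, ψ (f y) = h.equiv (φ y, 0) := fun y hy => by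
    have : ψ (f (φ.symm (φ y))) = h.equiv (φ y, 0) := h.writtenInCharts (φ.map_source hy)
    rwa [φ.left_inv hy] at this
  have hto : IsOpen φ.target := h.domChart.isOpen_extend_target
  set r : N → E := fun z => (h.equiv.symm (ψ z)).1 with hr
  have hrf : ∀ y ∈ φ.source, r (f y) = φ y := fun y hy => by simp [hr, key y hy]
  have hrc : ContMDiffOn J 𝓘(ℝ, E) ∞ r h.codChart.source :=
    (contDiff_fst.comp h.equiv.symm.contDiff).contMDiff.comp_contMDiffOn
      (h.codChart.contMDiffOn_extend h.codChart_mem_maximalAtlas)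
  refine ⟨fun z => φ.symm (r z), h.codChart.source ∩ r ⁻¹' φ.target,
    hrc.continuousOn.isOpen_inter_preimage h.codChart.open_source hto,
    ⟨h.mem_codChart_source, ?_⟩, ?_, ?_⟩
  · rw [mem_preimage, hrf x hxφ]; exact φ.map_source hxφ
  · have : I '' h.domChart.target = φ.target := by
      rw [hφ, OpenPartialHomeomorph.extend_target, I.range_eq_univ, inter_univ, I.image_eq,
        I.range_eq_univ, inter_univ]
    have h2 := contMDiffOn_extend_symm h.domChart_mem_maximalAtlas
    rw [this] at h2
    exact h2.comp (hrc.mono inter_subset_left) fun z hz => hz.2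
  · have hsrc : φ.source ∈ 𝓝 x := by
      rw [hφ, OpenPartialHomeomorph.extend_source]
      exact h.domChart.open_source.mem_nhds h.mem_domChart_source
    filter_upwards [hsrc] with y hy
    simp only [hrf y hy, φ.left_inv hy]

/-- By the chain rule, the differential of the retraction is a left inverse. -/
theorem ContMDiff.isImmersionAtOfComplement_of_retraction [I.Boundaryless] [J.Boundaryless]
    [IsManifold I ∞ M] [IsManifold J ∞ N] [FiniteDimensional ℝ E] [FiniteDimensional ℝ E']
    {f : M → N} (hf : ContMDiff I J ∞ f) {x : M} {R : N → M} (hR : MDifferentiableAt J I R (f x))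
    (h : ∀ᶠ y in 𝓝 x, R (f y) = y) :
    IsImmersionAtOfComplement (EuclideanSpace ℝ (Fin (finrank ℝ E' - finrank ℝ E))) I J ∞ f x := by
  refine hf.isImmersionAtOfComplement fun u v huv => ?_
  have h4 := modelDeriv_comp (J' := I) hR ((hf x).mdifferentiableAt (by simp))
  rw [modelDeriv_eq_id (f := R ∘ f) h] at h4
  have h5 := fun w => congrArg (fun A => A w) h4
  simp only [ContinuousLinearMap.id_apply, ContinuousLinearMap.comp_apply] at h5
  rw [h5 u, huv, ← h5 v]

/-- Smooth embeddings of finite dimensional manifolds without boundary compose. -/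
theorem Manifold.IsSmoothEmbedding.comp' [I.Boundaryless] [J.Boundaryless] [J'.Boundaryless]
    [IsManifold I ∞ M] [IsManifold J' ∞ Q] [FiniteDimensional ℝ E] [FiniteDimensional ℝ E'']
    {g : N → Q} {f : M → N} (hg : IsSmoothEmbedding J J' ∞ g) (hf : IsSmoothEmbedding I J ∞ f) :
    IsSmoothEmbedding I J' ∞ (g ∘ f) := by
  refine ⟨IsImmersionOfComplement.isImmersion (F := EuclideanSpace ℝ
    (Fin (finrank ℝ E'' - finrank ℝ E))) fun x => ?_, hg.isEmbedding.comp hf.isEmbedding⟩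
  obtain ⟨R, U, hU, hxU, hR, hRf⟩ :=
    (hf.isImmersion.isImmersionOfComplement_complement x).exists_retraction
  obtain ⟨R', U', hU', hxU', hR', hRg⟩ :=
    (hg.isImmersion.isImmersionOfComplement_complement (f x)).exists_retraction
  have hR'x : R' (g (f x)) = f x := hRg.self_of_nhds
  refine (hg.contMDiff.comp hf.contMDiff).isImmersionAtOfComplement_of_retraction
    (R := R ∘ R') ?_ ?_
  · refine MDifferentiableAt.comp (I' := J) _ ?_
      ((hR'.contMDiffAt (hU'.mem_nhds hxU')).mdifferentiableAt (by simp))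
    rw [Function.comp_apply, hR'x]
    exact (hR.contMDiffAt (hU.mem_nhds hxU)).mdifferentiableAt (by simp)
  · filter_upwards [hRf, hf.contMDiff.continuous.continuousAt.eventually hRg] with y hy hy'
    simp [hy, hy']

end LocalSections

/-! ### Embedded submanifolds from local parametrizations. -/

section Submanifolds

open Set Topology Module Manifold Filter

variable {E E' K K' M Q : Type*} [NormedAddCommGroup E] [NormedSpace ℝ E]
  [NormedAddCommGroup E'] [NormedSpace ℝ E']
  [TopologicalSpace K] [TopologicalSpace K']
  {I : ModelWithCorners ℝ E K} {J : ModelWithCorners ℝ E' K'}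
  [TopologicalSpace M] [ChartedSpace K M] [TopologicalSpace Q] [ChartedSpace K' Q]

variable (I) in
/-- A smooth parametrization `param : ℝᵐ → M` of `S`, defined on an open set, with a smooth left
inverse `coord` defined on an open subset of `M`. -/
structure LocalParam (S : Set M) (m : ℕ) where
  param : EuclideanSpace ℝ (Fin m) → M
  coord : M → EuclideanSpace ℝ (Fin m)
  dom : Set (EuclideanSpace ℝ (Fin m))
  nhd : Set M
  isOpen_dom : IsOpen dom
  isOpen_nhd : IsOpen nhd
  param_smooth : ContMDiffOn (𝓡 m) I ∞ param dom
  coord_smooth : ContMDiffOn I (𝓡 m) ∞ coord nhd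
  param_mem : ∀ w ∈ dom, param w ∈ S
  param_mem_nhd : ∀ w ∈ dom, param w ∈ nhd
  coord_mem : ∀ y ∈ S, y ∈ nhd → coord y ∈ dom
  coord_param : ∀ w ∈ dom, coord (param w) = w
  param_coord : ∀ y ∈ S, y ∈ nhd → param (coord y) = y

namespace LocalParam

variable {S : Set M} {m : ℕ}

open Classical in
/-- The chart of `S` given by a local parametrization. -/
noncomputable def chart (p : LocalParam I S m) (x : S) :
    OpenPartialHomeomorph S (EuclideanSpace ℝ (Fin m)) where
  toFun y := p.coord y
  invFun w := if hw : w ∈ p.dom then ⟨p.param w, p.param_mem w hw⟩ else x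
  source := Subtype.val ⁻¹' p.nhd
  target := p.dom
  map_source' y hy := p.coord_mem y y.2 hy
  map_target' w hw := by
    rw [dif_pos hw]; exact p.param_mem_nhd w hw
  left_inv' y hy := by
    rw [dif_pos (p.coord_mem y y.2 hy)]; exact Subtype.ext (p.param_coord y y.2 hy)
  right_inv' w hw := by
    rw [dif_pos hw]; exact p.coord_param w hw
  open_source := p.isOpen_nhd.preimage continuous_subtype_val
  open_target := p.isOpen_dom
  continuousOn_toFun :=
    p.coord_smooth.continuousOn.comp continuous_subtype_val.continuousOn fun _ hy => hy
  continuousOn_invFun := by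
    rw [Topology.IsInducing.subtypeVal.continuousOn_iff]
    refine p.param_smooth.continuousOn.congr fun w hw => ?_
    simp only [Function.comp_apply, dif_pos hw]

theorem val_chart_symm (p : LocalParam I S m) (x : S) {w : EuclideanSpace ℝ (Fin m)}
    (hw : w ∈ p.dom) : ((p.chart x).symm w : M) = p.param w :=
  congrArg Subtype.val (dif_pos hw)

end LocalParam

/-- A subset with smooth local parametrizations is an embedded submanifold. -/
theorem exists_submanifoldStructure [I.Boundaryless] [IsManifold I ∞ M] [FiniteDimensional ℝ E]
    {S : Set M} (m : ℕ) (h : ∀ x ∈ S, ∃ p : LocalParam I S m, x ∈ p.nhd) :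
    ∃ A : SubmanifoldStructure I S, A.dim = m := by
  choose p hp using fun x : S => h x x.2
  let cs : ChartedSpace (EuclideanSpace ℝ (Fin m)) S :=
    { atlas := range fun x : S => (p x).chart x
      chartAt := fun x => (p x).chart x
      mem_chart_source := fun x => hp x
      chart_mem_atlas := fun x => ⟨x, rfl⟩ }
  have hman : IsManifold (𝓡 m) ∞ S := by
    refine isManifold_of_contDiffOn _ _ _ ?_
    rintro _ _ ⟨x, rfl⟩ ⟨y, rfl⟩
    -- A transition map is a parametrization followed by coordinates defined on an open set of the
    -- ambient `M`, so it is smooth with no further argument.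
    have h1 : ContMDiffOn (𝓡 m) (𝓡 m) ∞ ((p y).coord ∘ (p x).param)
        ((p x).dom ∩ (p x).param ⁻¹' (p y).nhd) :=
      (p y).coord_smooth.comp ((p x).param_smooth.mono inter_subset_left) fun w hw => hw.2
    have h2 : (((p x).chart x).symm.trans ((p y).chart y)).source ⊆
        (p x).dom ∩ (p x).param ⁻¹' (p y).nhd := fun w hw => by
      rw [OpenPartialHomeomorph.trans_source] at hw
      refine ⟨hw.1, ?_⟩
      have h3 : (((p x).chart x).symm w : M) ∈ (p y).nhd := hw.2
      rwa [(p x).val_chart_symm x hw.1] at h3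
    refine ((contMDiffOn_iff_contDiffOn.mp h1).mono ?_).congr ?_
    · exact fun w hw => h2 hw.1
    · intro w hw
      exact congrArg (p y).coord ((p x).val_chart_symm x (h2 hw.1).1)
  have hval : ContMDiff (𝓡 m) I ∞ (Subtype.val : S → M) := by
    intro x
    have hc : ContMDiffAt (𝓡 m) (𝓡 m) ∞ ((p x).chart x) x :=
      contMDiffAt_of_mem_maximalAtlas (IsManifold.chart_mem_maximalAtlas x) (hp x)
    have h1 : ContMDiffAt (𝓡 m) I ∞ ((p x).param ∘ (p x).chart x) x :=
      ((p x).param_smooth.contMDiffAt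
        ((p x).isOpen_dom.mem_nhds ((p x).coord_mem x x.2 (hp x)))).comp x hc
    refine h1.congr_of_eventuallyEq ?_
    filter_upwards [((p x).chart x).open_source.mem_nhds (hp x)] with y hy
    exact ((p x).param_coord y y.2 hy).symm
  refine ⟨⟨m, cs, hman, IsImmersionOfComplement.isImmersion (F := EuclideanSpace ℝ
    (Fin (finrank ℝ E - finrank ℝ (EuclideanSpace ℝ (Fin m))))) fun x => ?_,
    Topology.IsEmbedding.subtypeVal⟩, rfl⟩
  refine hval.isImmersionAtOfComplement_of_retraction
    (R := ((p x).chart x).symm ∘ (p x).coord) ?_ ?_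
  · have h2 : ContMDiffAt (𝓡 m) (𝓡 m) ∞ ((p x).chart x).symm ((p x).coord x) :=
      contMDiffAt_symm_of_mem_maximalAtlas (IsManifold.chart_mem_maximalAtlas x)
        ((p x).coord_mem x x.2 (hp x))
    exact (h2.comp _ ((p x).coord_smooth.contMDiffAt
      ((p x).isOpen_nhd.mem_nhds (hp x)))).mdifferentiableAt (by simp)
  · filter_upwards [((p x).chart x).open_source.mem_nhds (hp x)] with y hy
    exact ((p x).chart x).left_inv hy

namespace SubmanifoldStructure

variable {S : Set M} (A : SubmanifoldStructure I S)

theorem contMDiff_val : ContMDiff (𝓡 A.dim) I ∞ (Subtype.val : S → M) :=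
  A.isSmoothEmbedding.contMDiff

/-- Smoothness into `S` can be tested in `M`: an immersion reflects smoothness of continuous maps,
and continuity is free for the subspace topology. -/
theorem contMDiffAt_iff {f : Q → S} {x : Q} :
    ContMDiffAt J (𝓡 A.dim) ∞ f x ↔ ContMDiffAt J I ∞ (fun y => (f y : M)) x := by
  rw [ContMDiffAt.iff_comp_isImmersionAt (A.isSmoothEmbedding.isImmersion.isImmersionAt (f x))]
  refine ⟨fun h => h.2, fun h => ⟨?_, h⟩⟩
  exact Topology.IsInducing.subtypeVal.continuousAt_iff.mpr h.continuousAt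

theorem contMDiff_iff {f : Q → S} :
    ContMDiff J (𝓡 A.dim) ∞ f ↔ ContMDiff J I ∞ (fun y => (f y : M)) :=
  forall_congr' fun _ => A.contMDiffAt_iff

end SubmanifoldStructure

/-- The range of a smooth embedding is an embedded submanifold. -/
theorem Manifold.IsSmoothEmbedding.exists_submanifoldStructure [I.Boundaryless] [IsManifold I ∞ M]
    [FiniteDimensional ℝ E] {m : ℕ} [ChartedSpace (EuclideanSpace ℝ (Fin m)) Q]
    [IsManifold (𝓡 m) ∞ Q] {f : Q → M} (hf : IsSmoothEmbedding (𝓡 m) I ∞ f) {S : Set M}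
    (hS : range f = S) : ∃ A : SubmanifoldStructure I S, A.dim = m := by
  subst hS
  refine _root_.exists_submanifoldStructure m ?_
  rintro _ ⟨q, rfl⟩
  obtain ⟨R, U, hU, hxU, hR, hRf⟩ :=
    (hf.isImmersion.isImmersionOfComplement_complement q).exists_retraction
  set χ := chartAt (EuclideanSpace ℝ (Fin m)) q with hχ
  obtain ⟨O, hO, hOo, hqO⟩ := mem_nhds_iff.mp hRf
  -- Here the embedding property enters: every point of the range in the ambient open set `U₁` comes
  -- from the neighbourhood of `q` on which `R` inverts `f`.
  obtain ⟨U₁, hU₁, hU₁O⟩ := hf.isEmbedding.isOpen_iff.mp (hOo.inter χ.open_source)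
  have hRq : R (f q) = q := hRf.self_of_nhds
  have hχs : ContMDiffOn (𝓡 m) (𝓡 m) ∞ χ χ.source := contMDiffOn_chart
  have hχt : ContMDiffOn (𝓡 m) (𝓡 m) ∞ χ.symm χ.target := contMDiffOn_chart_symm
  have hmem : ∀ y, f y ∈ U₁ → R (f y) = y ∧ y ∈ χ.source := fun y hy => by
    have : y ∈ O ∩ χ.source := hU₁O ▸ hy
    exact ⟨hO this.1, this.2⟩
  have hfc := hf.contMDiff.continuous
  refine ⟨{ param := fun w => f (χ.symm w)
            coord := fun y => χ (R y)
            dom := χ.target ∩ χ.symm ⁻¹' (f ⁻¹' (U₁ ∩ (U ∩ R ⁻¹' χ.source)))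
            nhd := U₁ ∩ (U ∩ R ⁻¹' χ.source)
            isOpen_dom := ?_
            isOpen_nhd := ?_
            param_smooth := ?_
            coord_smooth := ?_
            param_mem := fun w _ => mem_range_self _
            param_mem_nhd := fun w hw => hw.2
            coord_mem := ?_
            coord_param := ?_
            param_coord := ?_ }, ?_⟩
  · exact χ.continuousOn_symm.isOpen_inter_preimage χ.open_target
      ((hU₁.inter (hR.continuousOn.isOpen_inter_preimage hU χ.open_source)).preimage hfc)
  · exact hU₁.inter (hR.continuousOn.isOpen_inter_preimage hU χ.open_source)
  · exact hf.contMDiff.comp_contMDiffOn (hχt.mono inter_subset_left)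
  · exact hχs.comp (hR.mono fun y hy => hy.2.1) fun y hy => hy.2.2
  · rintro _ ⟨y, rfl⟩ hy
    obtain ⟨h1, h2⟩ := hmem y hy.1
    rw [h1]
    refine ⟨χ.map_source h2, ?_⟩
    rw [mem_preimage, χ.left_inv h2]; exact hy
  · intro w hw
    simp only [(hmem _ hw.2.1).1, χ.right_inv hw.1]
  · rintro _ ⟨y, rfl⟩ hy
    obtain ⟨h1, h2⟩ := hmem y hy.1
    simp only [h1, χ.left_inv h2]
  · refine ⟨?_, hxU, ?_⟩
    · change q ∈ f ⁻¹' U₁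
      rw [hU₁O]; exact ⟨hqO, mem_chart_source _ _⟩
    · rw [mem_preimage, hRq]; exact mem_chart_source _ _

end Submanifolds

/-! ### Fibre products of a submersion with a smooth map. -/

section FibreProducts

open Set Topology Module Manifold Filter

variable {E E' E'' K K' K'' M N Z : Type*} [NormedAddCommGroup E] [NormedSpace ℝ E]
  [NormedAddCommGroup E'] [NormedSpace ℝ E'] [NormedAddCommGroup E''] [NormedSpace ℝ E'']
  [TopologicalSpace K] [TopologicalSpace K'] [TopologicalSpace K'']
  {I : ModelWithCorners ℝ E K} {J : ModelWithCorners ℝ E' K'} {J' : ModelWithCorners ℝ E'' K''}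
  [TopologicalSpace M] [ChartedSpace K M] [TopologicalSpace N] [ChartedSpace K' N]
  [TopologicalSpace Z] [ChartedSpace K'' Z]

/-- The fibre product of a submersion `f` and a smooth map `g` has smooth local parametrizations. -/
theorem exists_localParam_fibreProduct {F : Type*} [NormedAddCommGroup F] [NormedSpace ℝ F]
    [I.Boundaryless] [J'.Boundaryless] [IsManifold J' ∞ Z]
    {f : M → N} {g : Z → N} {m : ℕ} (L : (F × E'') ≃L[ℝ] EuclideanSpace ℝ (Fin m))
    {x : M} {z : Z} (h : IsSubmersionAtOfComplement F I J ∞ f x) (hg : ContMDiff J' J ∞ g)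
    (hxz : f x = g z) :
    ∃ p : LocalParam (I.prod J') {q : M × Z | f q.1 = g q.2} m, (x, z) ∈ p.nhd := by
  set φ := h.domChart.extend I with hφ
  set ψ := h.codChart.extend J with hψ
  set χ := extChartAt J' z with hχ
  have hxφ : x ∈ φ.source := by
    rw [hφ, OpenPartialHomeomorph.extend_source]; exact h.mem_domChart_source
  have hφo : IsOpen φ.source := by
    rw [hφ, OpenPartialHomeomorph.extend_source]; exact h.domChart.open_source
  have hψs : ψ.source = h.codChart.source := by rw [hψ, OpenPartialHomeomorph.extend_source]
  have hψo : IsOpen ψ.source := hψs ▸ h.codChart.open_source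
  have hfxψ : f x ∈ ψ.source := hψs ▸ h.mem_codChart_source
  have hmaps : ∀ y ∈ φ.source, f y ∈ ψ.source := fun y hy => by
    rw [hφ, OpenPartialHomeomorph.extend_source] at hy
    exact hψs ▸ h.mapsto_domChart_source_codChart_source hy
  have key : ∀ y ∈ φ.source, ψ (f y) = (h.equiv (φ y)).1 := fun y hy => by
    have : ψ (f (φ.symm (φ y))) = (h.equiv (φ y)).1 := h.writtenInCharts (φ.map_source hy)
    rwa [φ.left_inv hy] at this
  have hφt : IsOpen φ.target := h.domChart.isOpen_extend_target
  have hφsymm : ContMDiffOn 𝓘(ℝ, E) I ∞ φ.symm φ.target := by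
    have : I '' h.domChart.target = φ.target := by
      rw [hφ, OpenPartialHomeomorph.extend_target, I.range_eq_univ, inter_univ, I.image_eq,
        I.range_eq_univ, inter_univ]
    have h2 := contMDiffOn_extend_symm h.domChart_mem_maximalAtlas
    rwa [this] at h2
  have hφs : ContMDiffOn I 𝓘(ℝ, E) ∞ φ φ.source := by
    rw [hφ, OpenPartialHomeomorph.extend_source]
    exact h.domChart.contMDiffOn_extend h.domChart_mem_maximalAtlas
  have hψsm : ContMDiffOn J 𝓘(ℝ, E') ∞ ψ ψ.source :=
    hψs ▸ h.codChart.contMDiffOn_extend h.codChart_mem_maximalAtlas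
  have hχsymm : ContMDiffOn 𝓘(ℝ, E'') J' ∞ χ.symm χ.target := contMDiffOn_extChartAt_symm z
  have hχs : ContMDiffOn J' 𝓘(ℝ, E'') ∞ χ χ.source := by
    rw [hχ, extChartAt_source]; exact contMDiffOn_extChartAt
  have hχo : IsOpen χ.source := isOpen_extChartAt_source z
  have hχt : IsOpen χ.target := isOpen_extChartAt_target z
  -- A parameter `w` encodes, through `L`, a fibre coordinate of the submersion and a coordinate on
  -- `Z`.
  set ζ : EuclideanSpace ℝ (Fin m) → Z := fun w => χ.symm (L.symm w).2 with hζ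
  set T₀ : Set (EuclideanSpace ℝ (Fin m)) := (fun w => (L.symm w).2) ⁻¹' χ.target with hT₀
  have hT₀o : IsOpen T₀ := hχt.preimage (continuous_snd.comp L.symm.continuous)
  have hζs : ContMDiffOn (𝓡 m) J' ∞ ζ T₀ :=
    hχsymm.comp ((contDiff_snd.comp L.symm.contDiff).contMDiff.contMDiffOn) fun w hw => hw
  set T₁ := T₀ ∩ ζ ⁻¹' (g ⁻¹' ψ.source) with hT₁
  have hT₁o : IsOpen T₁ :=
    hζs.continuousOn.isOpen_inter_preimage hT₀o (hψo.preimage hg.continuous)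
  -- In the adapted chart of `M`, the base coordinate is forced by `g (ζ w)` while the fibre
  -- coordinate is free.
  set u : EuclideanSpace ℝ (Fin m) → E :=
    fun w => h.equiv.symm (ψ (g (ζ w)), (L.symm w).1) with hu
  have hus : ContMDiffOn (𝓡 m) 𝓘(ℝ, E) ∞ u T₁ :=
    h.equiv.symm.contDiff.contMDiff.comp_contMDiffOn
      ((hψsm.comp (hg.comp_contMDiffOn (hζs.mono inter_subset_left)) fun w hw => hw.2).prodMk_space
        (contDiff_fst.comp L.symm.contDiff).contMDiff.contMDiffOn)
  have hS : ∀ q ∈ {q : M × Z | f q.1 = g q.2}, q.1 ∈ φ.source → q.2 ∈ χ.source →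
      ζ (L ((h.equiv (φ q.1)).2, χ q.2)) = q.2 ∧ u (L ((h.equiv (φ q.1)).2, χ q.2)) = φ q.1 := by
    rintro ⟨y, z'⟩ hq hy hz'
    have h1 : ζ (L ((h.equiv (φ y)).2, χ z')) = z' := by
      simp only [hζ, L.symm_apply_apply, χ.left_inv hz']
    refine ⟨h1, ?_⟩
    simp only [hu, h1, L.symm_apply_apply]
    rw [← show f y = g z' from hq, key y hy, h.equiv.symm_apply_apply]
  refine ⟨{ param := fun w => (φ.symm (u w), ζ w)
            coord := fun q => L ((h.equiv (φ q.1)).2, χ q.2)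
            dom := T₁ ∩ u ⁻¹' φ.target
            nhd := φ.source ×ˢ (χ.source ∩ g ⁻¹' ψ.source)
            isOpen_dom := hus.continuousOn.isOpen_inter_preimage hT₁o hφt
            isOpen_nhd := hφo.prod (hχo.inter (hψo.preimage hg.continuous))
            param_smooth := ?_
            coord_smooth := ?_
            param_mem := ?_
            param_mem_nhd := ?_
            coord_mem := ?_
            coord_param := ?_
            param_coord := ?_ }, ?_⟩
  · exact (hφsymm.comp (hus.mono inter_subset_left) fun w hw => hw.2).prodMk
      (hζs.mono fun w hw => hw.1.1)
  · refine L.contDiff.contMDiff.comp_contMDiffOn (ContMDiffOn.prodMk_space ?_ ?_)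
    · exact (contDiff_snd.comp h.equiv.contDiff).contMDiff.comp_contMDiffOn
        (hφs.comp contMDiffOn_fst fun q hq => hq.1)
    · exact hχs.comp contMDiffOn_snd fun q hq => hq.2.1
  · intro w hw
    have h1 : φ.symm (u w) ∈ φ.source := φ.map_target hw.2
    refine ψ.injOn (hmaps _ h1) hw.1.2 ?_
    rw [key _ h1, φ.right_inv hw.2]
    simp [hu]
  · exact fun w hw => ⟨φ.map_target hw.2, χ.map_target hw.1.1, hw.1.2⟩
  · intro q hq hn
    obtain ⟨h1, h2⟩ := hS q hq hn.1 hn.2.1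
    refine ⟨⟨?_, ?_⟩, ?_⟩
    · rw [hT₀, mem_preimage, L.symm_apply_apply]; exact χ.map_source hn.2.1
    · rw [mem_preimage, h1]; exact hn.2.2
    · rw [mem_preimage, h2]; exact φ.map_source hn.1
  · intro w hw
    simp only [φ.right_inv hw.2]
    rw [hu, hζ]
    simp only [h.equiv.apply_symm_apply, χ.right_inv hw.1.1, Prod.mk.eta, L.apply_symm_apply]
  · intro q hq hn
    obtain ⟨h1, h2⟩ := hS q hq hn.1 hn.2.1
    simp only [h1, h2, φ.left_inv hn.1]
  · exact ⟨hxφ, mem_extChartAt_source z, by rw [mem_preimage, ← hxz]; exact hfxψ⟩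

/-- The fibre product of a submersion and a smooth map is an embedded submanifold. -/
theorem Manifold.IsSubmersion.nonempty_submanifoldStructure
    [I.Boundaryless] [J'.Boundaryless] [IsManifold I ∞ M] [IsManifold J' ∞ Z]
    [FiniteDimensional ℝ E] [FiniteDimensional ℝ E'']
    {f : M → N} {g : Z → N} (hf : IsSubmersion I J ∞ f) (hg : ContMDiff J' J ∞ g) :
    Nonempty (SubmanifoldStructure (I.prod J') {q : M × Z | f q.1 = g q.2}) := by
  -- Finite dimensionality of the complement is read off from the adapted chart at some point. If
  -- `M` is empty, so is the fibre product, and dimension `0` will do.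
  by_cases hM : Nonempty M
  · have h := hf.isSubmersionOfComplement_complement
    have : FiniteDimensional ℝ hf.complement := by
      have e := (h hM.some).equiv
      exact FiniteDimensional.of_surjective
        ((LinearMap.snd ℝ E' hf.complement) ∘ₗ e.toLinearEquiv.toLinearMap)
        (Prod.snd_surjective.comp e.surjective)
    have L : (hf.complement × E'') ≃L[ℝ]
        EuclideanSpace ℝ (Fin (finrank ℝ (hf.complement × E''))) :=
      ContinuousLinearEquiv.ofFinrankEq (by rw [finrank_euclideanSpace_fin])
    obtain ⟨A, -⟩ := exists_submanifoldStructure (I := I.prod J')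
      (S := {q : M × Z | f q.1 = g q.2}) _
      fun q hq => exists_localParam_fibreProduct L (h q.1) hg hq
    exact ⟨A⟩
  · obtain ⟨A, -⟩ := exists_submanifoldStructure (I := I.prod J')
      (S := {q : M × Z | f q.1 = g q.2}) 0 fun q _ => (hM ⟨q.1⟩).elim
    exact ⟨A⟩

end FibreProducts

/-- Local sections meet the equations that define `S` only near the base point. Elsewhere the lift
takes the constant value `F x`, which does not affect smoothness at `x`. -/
theorem SubmanifoldStructure.exists_lift {E E' K K' M Q : Type*} [NormedAddCommGroup E]
    [NormedSpace ℝ E] [NormedAddCommGroup E'] [NormedSpace ℝ E']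
    [TopologicalSpace K] [TopologicalSpace K']
    {I : ModelWithCorners ℝ E K} {J : ModelWithCorners ℝ E' K'}
    [TopologicalSpace M] [ChartedSpace K M] [TopologicalSpace Q] [ChartedSpace K' Q]
    {S : Set M} (A : SubmanifoldStructure I S) {F : Q → M} {x : Q}
    (hF : ContMDiffAt J I ∞ F x) (hS : ∀ᶠ y in nhds x, F y ∈ S) :
    ∃ f : Q → S, ContMDiffAt J (𝓡 A.dim) ∞ f x ∧ ∀ᶠ y in nhds x, (f y : M) = F y := by
  classical
  have hf : ∀ᶠ y in nhds x,
      ((if h : F y ∈ S then ⟨F y, h⟩ else ⟨F x, hS.self_of_nhds⟩ : S) : M) = F y := by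
    filter_upwards [hS] with y hy
    rw [dif_pos hy]
  exact ⟨_, A.contMDiffAt_iff.mpr (hF.congr_of_eventuallyEq hf), hf⟩

/-! ### Calculus in groupoids and Lie groupoids. -/

namespace Gpd

variable {P G : Type*} (𝒢 : Gpd P G)

open Classical in
/-- The composition of a groupoid, extended by a junk value to all pairs of arrows. -/
noncomputable def mulTotal (a b : G) : G :=
  if h : 𝒢.tgt a = 𝒢.src b then 𝒢.mul a b h else a

variable {𝒢}

theorem mul_eq_mulTotal {a b : G} (h : 𝒢.tgt a = 𝒢.src b) : 𝒢.mul a b h = 𝒢.mulTotal a b :=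
  (dif_pos h).symm

theorem src_mulTotal {a b : G} (h : 𝒢.tgt a = 𝒢.src b) :
    𝒢.src (𝒢.mulTotal a b) = 𝒢.src a := by
  rw [← mul_eq_mulTotal h, 𝒢.src_mul]

theorem tgt_mulTotal {a b : G} (h : 𝒢.tgt a = 𝒢.src b) :
    𝒢.tgt (𝒢.mulTotal a b) = 𝒢.tgt b := by
  rw [← mul_eq_mulTotal h, 𝒢.tgt_mul]

theorem mulTotal_assoc {a b c : G} (hab : 𝒢.tgt a = 𝒢.src b) (hbc : 𝒢.tgt b = 𝒢.src c) :
    𝒢.mulTotal (𝒢.mulTotal a b) c = 𝒢.mulTotal a (𝒢.mulTotal b c) := by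
  have h := 𝒢.mul_assoc a b c hab hbc
  simpa only [mul_eq_mulTotal] using h

theorem inv_mulTotal_cancel_right {a c : G} (h : 𝒢.tgt a = 𝒢.tgt c) :
    𝒢.mulTotal (𝒢.mulTotal a (𝒢.inv c)) c = a := by
  rw [mulTotal_assoc (h.trans (𝒢.src_inv c).symm) (𝒢.tgt_inv c),
    ← mul_eq_mulTotal (𝒢.tgt_inv c), 𝒢.inv_mul, ← h, ← mul_eq_mulTotal (𝒢.src_one _).symm,
    𝒢.mul_one]

theorem mulTotal_inv_cancel_left {a c : G} (h : 𝒢.src a = 𝒢.src c) :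
    𝒢.mulTotal c (𝒢.mulTotal (𝒢.inv c) a) = a := by
  rw [← mulTotal_assoc (𝒢.src_inv c).symm ((𝒢.tgt_inv c).trans h.symm),
    ← mul_eq_mulTotal (𝒢.src_inv c).symm, 𝒢.mul_inv, ← h, ← mul_eq_mulTotal (𝒢.tgt_one _),
    𝒢.one_mul]

theorem inv_mulTotal_cancel_left {a c : G} (h : 𝒢.tgt c = 𝒢.src a) :
    𝒢.mulTotal (𝒢.inv c) (𝒢.mulTotal c a) = a := by
  rw [← mulTotal_assoc (𝒢.tgt_inv c) h, ← mul_eq_mulTotal (𝒢.tgt_inv c), 𝒢.inv_mul, h,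
    ← mul_eq_mulTotal (𝒢.tgt_one _), 𝒢.one_mul]

theorem mulTotal_inv (a : G) : 𝒢.mulTotal a (𝒢.inv a) = 𝒢.one (𝒢.src a) := by
  rw [← mul_eq_mulTotal (𝒢.src_inv a).symm, 𝒢.mul_inv]

theorem inv_inv (a : G) : 𝒢.inv (𝒢.inv a) = a :=
  (𝒢.eq_inv (𝒢.tgt_inv a) (by rw [𝒢.inv_mul, 𝒢.src_inv])).symm

/-- If `ξ γ = a⁻¹ δ c⁻¹`, then `(a ξ) (γ c) = δ`. -/
theorem mulTotal_sandwich {a ξ γ c δ : G} (haξ : 𝒢.tgt a = 𝒢.src ξ) (hξγ : 𝒢.tgt ξ = 𝒢.src γ)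
    (hγc : 𝒢.tgt γ = 𝒢.src c) (haδ : 𝒢.src a = 𝒢.src δ) (hδc : 𝒢.tgt δ = 𝒢.tgt c)
    (h : 𝒢.mulTotal ξ γ = 𝒢.mulTotal (𝒢.mulTotal (𝒢.inv a) δ) (𝒢.inv c)) :
    𝒢.mulTotal (𝒢.mulTotal a ξ) (𝒢.mulTotal γ c) = δ := by
  have hia : 𝒢.tgt (𝒢.inv a) = 𝒢.src δ := (𝒢.tgt_inv a).trans haδ
  rw [mulTotal_assoc haξ (hξγ.trans (src_mulTotal hγc).symm), ← mulTotal_assoc hξγ hγc, h,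
    inv_mulTotal_cancel_right ((tgt_mulTotal hia).trans hδc), mulTotal_inv_cancel_left haδ.symm]

section Lie

open Manifold

variable {E K Z : Type*} [NormedAddCommGroup E] [NormedSpace ℝ E] [TopologicalSpace K]
  {J : ModelWithCorners ℝ E K} [TopologicalSpace Z] [ChartedSpace K Z] {p g : ℕ}
  [TopologicalSpace P] [ChartedSpace (EuclideanSpace ℝ (Fin p)) P]
  [TopologicalSpace G] [ChartedSpace (EuclideanSpace ℝ (Fin g)) G]

theorem IsLie.contMDiff_mul (h𝒢 : 𝒢.IsLie p g) {a b : Z → G} (ha : ContMDiff J (𝓡 g) ∞ a)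
    (hb : ContMDiff J (𝓡 g) ∞ b) (h : ∀ z, 𝒢.tgt (a z) = 𝒢.src (b z)) :
    ContMDiff J (𝓡 g) ∞ fun z => 𝒢.mul (a z) (b z) (h z) := by
  obtain ⟨A, hA⟩ := h𝒢.comp_smooth
  have h1 : ContMDiff J (𝓡 A.dim) ∞ fun z => (⟨(a z, b z), h z⟩ : 𝒢.composable) :=
    A.contMDiff_iff.mpr (ha.prodMk hb)
  exact hA.comp h1

theorem IsLie.contMDiffAt_mulTotal (h𝒢 : 𝒢.IsLie p g) {a b : Z → G} {z : Z}
    (ha : ContMDiffAt J (𝓡 g) ∞ a z) (hb : ContMDiffAt J (𝓡 g) ∞ b z)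
    (h : ∀ᶠ y in nhds z, 𝒢.tgt (a y) = 𝒢.src (b y)) :
    ContMDiffAt J (𝓡 g) ∞ (fun y => 𝒢.mulTotal (a y) (b y)) z := by
  obtain ⟨A, hA⟩ := h𝒢.comp_smooth
  obtain ⟨f, hf, hfe⟩ := A.exists_lift (ha.prodMk hb) h
  refine ((hA (f z)).comp z hf).congr_of_eventuallyEq ?_
  filter_upwards [hfe] with y hy
  have h1 : (f y).1.1 = a y := congrArg Prod.fst hy
  have h2 : (f y).1.2 = b y := congrArg Prod.snd hy
  rw [← h1, ← h2, Function.comp_apply, ← mul_eq_mulTotal (f y).2]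
  rfl

/-- A criterion for a groupoid to be a Lie groupoid. -/
theorem IsLie.of_hasLocalSectionAt (base : IsSmoothManifold p P) (arrows : IsSmoothManifold g G)
    (src_smooth : ContMDiff (𝓡 g) (𝓡 p) ∞ 𝒢.src)
    (src_section : ∀ a, HasLocalSectionAt (𝓡 g) (𝓡 p) 𝒢.src a)
    (one_smooth : ContMDiff (𝓡 p) (𝓡 g) ∞ 𝒢.one) (inv_smooth : ContMDiff (𝓡 g) (𝓡 g) ∞ 𝒢.inv)
    (comp_smooth : ∀ A : SubmanifoldStructure ((𝓡 g).prod (𝓡 g)) 𝒢.composable,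
      ContMDiff (𝓡 A.dim) (𝓡 g) ∞ 𝒢.comp) : 𝒢.IsLie p g := by
  have := base.isManifold
  have := arrows.isManifold
  have htgt : 𝒢.src ∘ 𝒢.inv = 𝒢.tgt := funext 𝒢.src_inv
  have inv_section : ∀ a, HasLocalSectionAt (𝓡 g) (𝓡 g) 𝒢.inv a := fun a =>
    ⟨𝒢.inv, inv_inv a, inv_smooth _, Filter.Eventually.of_forall inv_inv⟩
  have tgt_submersion : IsSubmersion (𝓡 g) (𝓡 p) ∞ 𝒢.tgt := by
    -- The end map is the source map after inversion, and inversion is its own section.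
    rw [← htgt]
    exact (src_smooth.comp inv_smooth).isSubmersion_of_hasLocalSectionAt fun a =>
      (src_section _).comp (inv_section a)
  -- Only now are the composable pairs known to form a submanifold, which is why `comp_smooth` is
  -- assumed for every such structure.
  obtain ⟨A⟩ := tgt_submersion.nonempty_submanifoldStructure src_smooth
  exact ⟨base, arrows, fun q => ⟨𝒢.one q, 𝒢.src_one q⟩,
    src_smooth.isSubmersion_of_hasLocalSectionAt src_section, fun q => ⟨𝒢.one q, 𝒢.tgt_one q⟩,
    tgt_submersion, one_smooth, inv_smooth, A, comp_smooth A⟩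

end Lie

end Gpd

theorem IsGpdHom.map_mulTotal {P G P' G' : Type*} {𝒢 : Gpd P G} {𝒢' : Gpd P' G'}
    {φ : G → G'} {φ₀ : P → P'} (hφ : IsGpdHom 𝒢 𝒢' φ φ₀) {a b : G} (h : 𝒢.tgt a = 𝒢.src b) :
    φ (𝒢.mulTotal a b) = 𝒢'.mulTotal (φ a) (φ b) := by
  rw [← Gpd.mul_eq_mulTotal h, hφ.mul a b h, Gpd.mul_eq_mulTotal]

/-! ### The maps `Φ` and `Ψ` are submersions. -/

namespace GpdDiagram

variable {P V H D : Type*} {𝒱 : Gpd P V} {ℋ : Gpd P H} {𝒟 : Gpd P D}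

/-- The diagram with the roles of `H` and `V` exchanged. -/
def swap (Δ : GpdDiagram 𝒱 ℋ 𝒟) : GpdDiagram ℋ 𝒱 𝒟 := ⟨Δ.j, Δ.i, Δ.hom_j, Δ.hom_i⟩

variable (Δ : GpdDiagram 𝒱 ℋ 𝒟)

theorem Phi_eq (q : {q : H × V | ℋ.tgt q.1 = 𝒱.src q.2}) :
    Δ.Phi q = 𝒟.mulTotal (Δ.i q.1.1) (Δ.j q.1.2) :=
  Gpd.mul_eq_mulTotal _

theorem src_Phi (q : {q : H × V | ℋ.tgt q.1 = 𝒱.src q.2}) : 𝒟.src (Δ.Phi q) = ℋ.src q.1.1 :=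
  (𝒟.src_mul _ _ _).trans (Δ.hom_i.src _)

theorem tgt_Phi (q : {q : H × V | ℋ.tgt q.1 = 𝒱.src q.2}) : 𝒟.tgt (Δ.Phi q) = 𝒱.tgt q.1.2 :=
  (𝒟.tgt_mul _ _ _).trans (Δ.hom_j.tgt _)

/-- The pair of identities at a point of the base. -/
def unitPair (𝒱 : Gpd P V) (ℋ : Gpd P H) (p : P) : {q : H × V | ℋ.tgt q.1 = 𝒱.src q.2} :=
  ⟨(ℋ.one p, 𝒱.one p), (ℋ.tgt_one p).trans (𝒱.src_one p).symm⟩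

theorem Phi_unitPair (p : P) : Δ.Phi (unitPair 𝒱 ℋ p) = 𝒟.one p := by
  have h : 𝒟.tgt (Δ.i (ℋ.one p)) = 𝒟.src (𝒟.one p) := by
    rw [Δ.hom_i.one]; exact (𝒟.tgt_one _).trans (𝒟.src_one _).symm
  have h2 : Δ.Phi (unitPair 𝒱 ℋ p) = 𝒟.mulTotal (Δ.i (ℋ.one p)) (Δ.j (𝒱.one p)) := Δ.Phi_eq _
  rw [h2, show Δ.j (𝒱.one p) = 𝒟.one p from Δ.hom_j.one p, ← Gpd.mul_eq_mulTotal h,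
    𝒟.mul_one' h]
  exact Δ.hom_i.one p

section Lie

open Manifold Filter Topology

variable {p v h d : ℕ}
  [TopologicalSpace V] [ChartedSpace (EuclideanSpace ℝ (Fin v)) V]
  [TopologicalSpace H] [ChartedSpace (EuclideanSpace ℝ (Fin h)) H]
  [TopologicalSpace D] [ChartedSpace (EuclideanSpace ℝ (Fin d)) D]
  {Δ}

theorem TransversalAtIdentities.swap (htr : Δ.TransversalAtIdentities v h d) :
    Δ.swap.TransversalAtIdentities h v d :=
  fun q => (sup_comm _ _).trans (htr q)

variable [TopologicalSpace P] [ChartedSpace (EuclideanSpace ℝ (Fin p)) P]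

theorem IsLie.swap (hΔ : Δ.IsLie p v h d) : Δ.swap.IsLie p h v d :=
  ⟨hΔ.horiz, hΔ.vert, hΔ.diag, hΔ.j_smooth, hΔ.i_smooth⟩

theorem IsLie.contMDiff_Phi (hΔ : Δ.IsLie p v h d)
    (A : SubmanifoldStructure ((𝓡 h).prod (𝓡 v)) {q : H × V | ℋ.tgt q.1 = 𝒱.src q.2}) :
    ContMDiff (𝓡 A.dim) (𝓡 d) ∞ Δ.Phi :=
  hΔ.diag.contMDiff_mul (hΔ.i_smooth.comp (contMDiff_fst.comp A.contMDiff_val))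
    (hΔ.j_smooth.comp (contMDiff_snd.comp A.contMDiff_val)) _

/-- `Φ` restricts to `i` and `j` on `{(x, id)}` and `{(id, g)}`, so transversality of `i` and `j`
makes it a submersion at the pairs of identities. -/
theorem IsLie.surjective_modelDeriv_Phi (hΔ : Δ.IsLie p v h d)
    (htr : Δ.TransversalAtIdentities v h d)
    (A : SubmanifoldStructure ((𝓡 h).prod (𝓡 v)) {q : H × V | ℋ.tgt q.1 = 𝒱.src q.2}) (q : P) :
    Function.Surjective (modelDeriv (𝓡 A.dim) (𝓡 d) Δ.Phi (unitPair 𝒱 ℋ q)) := by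
  let α : H → {q : H × V | ℋ.tgt q.1 = 𝒱.src q.2} :=
    fun x => ⟨(x, 𝒱.one (ℋ.tgt x)), (𝒱.src_one _).symm⟩
  let β : V → {q : H × V | ℋ.tgt q.1 = 𝒱.src q.2} :=
    fun g => ⟨(ℋ.one (𝒱.src g), g), ℋ.tgt_one _⟩
  have hα : ContMDiff (𝓡 h) (𝓡 A.dim) ∞ α := A.contMDiff_iff.mpr
    (contMDiff_id.prodMk (hΔ.vert.one_smooth.comp hΔ.horiz.tgt_submersion.contMDiff))
  have hβ : ContMDiff (𝓡 v) (𝓡 A.dim) ∞ β := A.contMDiff_iff.mpr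
    ((hΔ.horiz.one_smooth.comp hΔ.vert.src_submersion.contMDiff).prodMk contMDiff_id)
  have hΦ := hΔ.contMDiff_Phi A
  have hΦα : Δ.Phi ∘ α = Δ.i := funext fun x => by
    have h1 : 𝒟.tgt (Δ.i x) = 𝒟.src (𝒟.one (ℋ.tgt x)) :=
      (Δ.hom_i.tgt x).trans (𝒟.src_one _).symm
    exact (𝒟.mul_congr rfl (Δ.hom_j.one _) _ h1).trans (𝒟.mul_one' h1)
  have hΦβ : Δ.Phi ∘ β = Δ.j := funext fun g => by
    have h1 : 𝒟.tgt (𝒟.one (𝒱.src g)) = 𝒟.src (Δ.j g) :=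
      (𝒟.tgt_one _).trans (Δ.hom_j.src g).symm
    exact (𝒟.mul_congr (Δ.hom_i.one _) rfl _ h1).trans (𝒟.one_mul' h1)
  have hαq : α (ℋ.one q) = unitPair 𝒱 ℋ q :=
    Subtype.ext (Prod.ext rfl (congrArg 𝒱.one (ℋ.tgt_one q)))
  have hβq : β (𝒱.one q) = unitPair 𝒱 ℋ q :=
    Subtype.ext (Prod.ext (congrArg ℋ.one (𝒱.src_one q)) rfl)
  have h1 := modelDeriv_comp (I := 𝓡 h) (J := 𝓡 A.dim) (J' := 𝓡 d) (f := α) (g := Δ.Phi)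
    (x := ℋ.one q) ((hΦ _).mdifferentiableAt (by simp)) ((hα _).mdifferentiableAt (by simp))
  have h2 := modelDeriv_comp (I := 𝓡 v) (J := 𝓡 A.dim) (J' := 𝓡 d) (f := β) (g := Δ.Phi)
    (x := 𝒱.one q) ((hΦ _).mdifferentiableAt (by simp)) ((hβ _).mdifferentiableAt (by simp))
  rw [hΦα, hαq] at h1
  rw [hΦβ, hβq] at h2
  have htop : (modelDeriv (𝓡 h) (𝓡 d) Δ.i (ℋ.one q)).range ⊔
      (modelDeriv (𝓡 v) (𝓡 d) Δ.j (𝒱.one q)).range = ⊤ := htr q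
  rw [h1, h2] at htop
  refine LinearMap.range_eq_top.mp (top_le_iff.mp (htop.ge.trans (sup_le ?_ ?_)))
  · rintro _ ⟨w, rfl⟩; exact ⟨_, rfl⟩
  · rintro _ ⟨w, rfl⟩; exact ⟨_, rfl⟩

/-- Translation to the identities: local sections of `l` and `b` move a neighbourhood of `Φ(q)` to
one of an identity of `D`, where transversality supplies a section. -/
theorem IsLie.hasLocalSectionAt_Phi (hΔ : Δ.IsLie p v h d)
    (htr : Δ.TransversalAtIdentities v h d)
    (A : SubmanifoldStructure ((𝓡 h).prod (𝓡 v)) {q : H × V | ℋ.tgt q.1 = 𝒱.src q.2})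
    (q : {q : H × V | ℋ.tgt q.1 = 𝒱.src q.2}) :
    HasLocalSectionAt (𝓡 A.dim) (𝓡 d) Δ.Phi q := by
  have := hΔ.diag.arrows.isManifold
  have := A.isManifold
  obtain ⟨⟨x₀, g₀⟩, hq⟩ := q
  have hΦ := hΔ.contMDiff_Phi A
  set o := ℋ.tgt x₀ with ho
  obtain ⟨σ, hσ1, hσ2, hσ3⟩ := (hΦ.isSubmersionAtOfComplement
    (hΔ.surjective_modelDeriv_Phi htr A o)).hasLocalSectionAt
  obtain ⟨X, hX1, hX2, hX3⟩ := hΔ.horiz.src_submersion.hasLocalSectionAt x₀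
  obtain ⟨Y, hY1, hY2, hY3⟩ := hΔ.vert.tgt_submersion.hasLocalSectionAt g₀
  rw [Phi_unitPair] at hσ1 hσ2 hσ3
  set d₀ := Δ.Phi ⟨(x₀, g₀), hq⟩ with hd₀
  have hs₀ : 𝒟.src d₀ = ℋ.src x₀ := Δ.src_Phi _
  have ht₀ : 𝒟.tgt d₀ = 𝒱.tgt g₀ := Δ.tgt_Phi _
  have hsrc : ContMDiff (𝓡 d) (𝓡 p) ∞ 𝒟.src := hΔ.diag.src_submersion.contMDiff
  have htgt : ContMDiff (𝓡 d) (𝓡 p) ∞ 𝒟.tgt := hΔ.diag.tgt_submersion.contMDiff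
  have hXs : ContMDiffAt (𝓡 d) (𝓡 h) ∞ (fun c => X (𝒟.src c)) d₀ :=
    ContMDiffAt.comp d₀ (by rw [hs₀]; exact hX2) (hsrc d₀)
  have hYt : ContMDiffAt (𝓡 d) (𝓡 v) ∞ (fun c => Y (𝒟.tgt c)) d₀ :=
    ContMDiffAt.comp d₀ (by rw [ht₀]; exact hY2) (htgt d₀)
  have hXe : ∀ᶠ c in 𝓝 d₀, ℋ.src (X (𝒟.src c)) = 𝒟.src c :=
    (hsrc d₀).continuousAt.eventually (by rw [hs₀]; exact hX3)
  have hYe : ∀ᶠ c in 𝓝 d₀, 𝒱.tgt (Y (𝒟.tgt c)) = 𝒟.tgt c :=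
    (htgt d₀).continuousAt.eventually (by rw [ht₀]; exact hY3)
  set a : D → D := fun c => Δ.i (X (𝒟.src c)) with ha
  set b : D → D := fun c => Δ.j (Y (𝒟.tgt c)) with hb
  have has : ContMDiffAt (𝓡 d) (𝓡 d) ∞ a d₀ := (hΔ.i_smooth _).comp d₀ hXs
  have hbs : ContMDiffAt (𝓡 d) (𝓡 d) ∞ b d₀ := (hΔ.j_smooth _).comp d₀ hYt
  have hae : ∀ᶠ c in 𝓝 d₀, 𝒟.src (a c) = 𝒟.src c :=
    hXe.mono fun c hc => (Δ.hom_i.src _).trans hc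
  have hbe : ∀ᶠ c in 𝓝 d₀, 𝒟.tgt (b c) = 𝒟.tgt c :=
    hYe.mono fun c hc => (Δ.hom_j.tgt _).trans hc
  -- This is `i(X)⁻¹ c j(Y)⁻¹`, composable for `c` near `d₀` and equal to the identity at `o` for `c
  -- = d₀`.
  set δ : D → D := fun c => 𝒟.mulTotal (𝒟.mulTotal (𝒟.inv (a c)) c) (𝒟.inv (b c)) with hδ
  have hinv := hΔ.diag.inv_smooth
  have hδs : ContMDiffAt (𝓡 d) (𝓡 d) ∞ δ d₀ := by
    refine hΔ.diag.contMDiffAt_mulTotal (hΔ.diag.contMDiffAt_mulTotal ((hinv _).comp d₀ has)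
      contMDiffAt_id ?_) ((hinv _).comp d₀ hbs) ?_
    · filter_upwards [hae] with c hc
      exact (𝒟.tgt_inv _).trans hc
    · filter_upwards [hae, hbe] with c hc hc'
      exact ((Gpd.tgt_mulTotal ((𝒟.tgt_inv _).trans hc)).trans hc'.symm).trans (𝒟.src_inv _).symm
  have ha₀ : a d₀ = Δ.i x₀ := by simp only [ha, hs₀, hX1]
  have hb₀ : b d₀ = Δ.j g₀ := by simp only [hb, ht₀, hY1]
  have hδ₀ : δ d₀ = 𝒟.one o := by
    have h1 : 𝒟.tgt (Δ.i x₀) = 𝒟.src (Δ.j g₀) := Δ.tgt_i_eq hq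
    have h2 : d₀ = 𝒟.mulTotal (Δ.i x₀) (Δ.j g₀) := Δ.Phi_eq _
    simp only [hδ, ha₀, hb₀]
    rw [h2, Gpd.inv_mulTotal_cancel_left h1, Gpd.mulTotal_inv, ← h1, Δ.hom_i.tgt]
    rfl
  have hσδ : ContMDiffAt (𝓡 d) (𝓡 A.dim) ∞ (fun c => σ (δ c)) d₀ :=
    ContMDiffAt.comp d₀ (by rw [hδ₀]; exact hσ2) hδs
  have hσe : ∀ᶠ c in 𝓝 d₀, Δ.Phi (σ (δ c)) = δ c :=
    hδs.continuousAt.eventually (by rw [hδ₀]; exact hσ3)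
  have hσv : ContMDiffAt (𝓡 d) ((𝓡 h).prod (𝓡 v)) ∞ (fun c => (σ (δ c)).1) d₀ :=
    A.contMDiffAt_iff.mp hσδ
  have hcomp : ∀ᶠ c in 𝓝 d₀, ℋ.tgt (X (𝒟.src c)) = ℋ.src (σ (δ c)).1.1 ∧
      𝒱.tgt (σ (δ c)).1.2 = 𝒱.src (Y (𝒟.tgt c)) := by
    filter_upwards [hae, hbe, hσe] with c hc hc' hc''
    have h1 : 𝒟.tgt (𝒟.inv (a c)) = 𝒟.src c := (𝒟.tgt_inv _).trans hc
    have h2 : 𝒟.tgt (𝒟.mulTotal (𝒟.inv (a c)) c) = 𝒟.src (𝒟.inv (b c)) :=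
      ((Gpd.tgt_mulTotal h1).trans hc'.symm).trans (𝒟.src_inv _).symm
    constructor
    · rw [← Δ.src_Phi, hc'', hδ, Gpd.src_mulTotal h2, Gpd.src_mulTotal h1, 𝒟.src_inv]
      exact (Δ.hom_i.tgt _).symm
    · rw [← Δ.tgt_Phi, hc'', hδ, Gpd.tgt_mulTotal h2, 𝒟.tgt_inv]
      exact Δ.hom_j.src _
  -- With `σ (δ c) = (ξ, γ)`, the section is `c ↦ (X ξ, γ Y)`.
  obtain ⟨τ, hτ, hτe⟩ := A.exists_lift (Q := D) (x := d₀)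
    (F := fun c => (ℋ.mulTotal (X (𝒟.src c)) (σ (δ c)).1.1,
      𝒱.mulTotal (σ (δ c)).1.2 (Y (𝒟.tgt c))))
    ((hΔ.horiz.contMDiffAt_mulTotal hXs hσv.fst (hcomp.mono fun c hc => hc.1)).prodMk
      (hΔ.vert.contMDiffAt_mulTotal hσv.snd hYt (hcomp.mono fun c hc => hc.2)))
    (hcomp.mono fun c hc => by
      exact (Gpd.tgt_mulTotal hc.1).trans ((σ (δ c)).2.trans (Gpd.src_mulTotal hc.2).symm))
  refine ⟨τ, ?_, hτ, ?_⟩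
  · refine Subtype.ext (hτe.self_of_nhds.trans ?_)
    have h1 : (σ (δ d₀)).1 = (ℋ.one o, 𝒱.one o) := by rw [hδ₀, hσ1]; rfl
    have h2 : 𝒱.tgt (𝒱.one o) = 𝒱.src g₀ := (𝒱.tgt_one _).trans hq
    rw [h1, hs₀, ht₀, hX1, hY1, ← Gpd.mul_eq_mulTotal (ℋ.src_one _).symm, ℋ.mul_one,
      ← Gpd.mul_eq_mulTotal h2, 𝒱.one_mul' h2]
  · filter_upwards [hτe, hcomp, hσe, hae, hbe] with c hc hc' hc'' hc3 hc4
    have h1 : (τ c).1.1 = ℋ.mulTotal (X (𝒟.src c)) (σ (δ c)).1.1 := congrArg Prod.fst hc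
    have h2 : (τ c).1.2 = 𝒱.mulTotal (σ (δ c)).1.2 (Y (𝒟.tgt c)) := congrArg Prod.snd hc
    rw [Δ.Phi_eq, h1, h2, Δ.hom_i.map_mulTotal hc'.1, Δ.hom_j.map_mulTotal hc'.2]
    rw [Δ.Phi_eq] at hc''
    refine Gpd.mulTotal_sandwich ?_ (Δ.tgt_i_eq (σ (δ c)).2) ?_ hc3 hc4.symm hc''
    · rw [Δ.hom_i.tgt, Δ.hom_i.src]; exact hc'.1
    · rw [Δ.hom_j.tgt, Δ.hom_j.src]; exact hc'.2

theorem IsLie.isSubmersion_Phi (hΔ : Δ.IsLie p v h d) (htr : Δ.TransversalAtIdentities v h d)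
    (A : SubmanifoldStructure ((𝓡 h).prod (𝓡 v)) {q : H × V | ℋ.tgt q.1 = 𝒱.src q.2}) :
    IsSubmersion (𝓡 A.dim) (𝓡 d) ∞ Δ.Phi := by
  have := hΔ.diag.arrows.isManifold
  have := A.isManifold
  exact (hΔ.contMDiff_Phi A).isSubmersion_of_hasLocalSectionAt (hΔ.hasLocalSectionAt_Phi htr A)

/-- `Ψ` is by definition the map `Φ` of the swapped diagram. -/
theorem IsLie.isSubmersion_Psi (hΔ : Δ.IsLie p v h d) (htr : Δ.TransversalAtIdentities v h d)
    (A : SubmanifoldStructure ((𝓡 v).prod (𝓡 h)) {q : V × H | 𝒱.tgt q.1 = ℋ.src q.2}) :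
    IsSubmersion (𝓡 A.dim) (𝓡 d) ∞ Δ.Psi :=
  hΔ.swap.isSubmersion_Phi htr.swap A

theorem IsLie.nonempty_submanifoldStructure (hΔ : Δ.IsLie p v h d) :
    Nonempty (SubmanifoldStructure ((𝓡 h).prod (𝓡 v)) {q : H × V | ℋ.tgt q.1 = 𝒱.src q.2}) := by
  have := hΔ.horiz.arrows.isManifold
  have := hΔ.vert.arrows.isManifold
  exact hΔ.horiz.tgt_submersion.nonempty_submanifoldStructure hΔ.vert.src_submersion.contMDiff

end Lie

end GpdDiagram

/-! ### The manifold of boxes and the double Lie groupoid. -/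

namespace GpdDiagram

variable {P V H D : Type*} {𝒱 : Gpd P V} {ℋ : Gpd P H} {𝒟 : Gpd P D} (Δ : GpdDiagram 𝒱 ℋ 𝒟)

theorem isSlim_square : Δ.square.IsSlim := fun _ _ h =>
  Subtype.ext (congrArg (fun q => q.1) h)

variable {Δ}

theorem tgt_inv_i {x : H} {f : V} (h : ℋ.src x = 𝒱.src f) :
    𝒟.tgt (𝒟.inv (Δ.i x)) = 𝒟.src (Δ.j f) := by
  rw [𝒟.tgt_inv, Δ.hom_i.src, Δ.hom_j.src]; exact h

/-- A factorization `i(x)⁻¹ j(f) = j(g) i(y)` completes the corner `(x, f)` to a box. -/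
theorem mem_boxSet_of_Psi_eq {x : H} {f : V} (h : ℋ.src x = 𝒱.src f)
    {q : {q : V × H | 𝒱.tgt q.1 = ℋ.src q.2}}
    (hq : Δ.Psi q = 𝒟.mul (𝒟.inv (Δ.i x)) (Δ.j f) (tgt_inv_i h)) :
    ((f, ℋ.inv q.1.2), (x, q.1.1)) ∈ Δ.boxSet := by
  obtain ⟨⟨g, y⟩, hgy⟩ := q
  have h1 : 𝒱.src g = ℋ.tgt x := by
    have := congrArg 𝒟.src hq
    rw [𝒟.src_mul, 𝒟.src_inv, Δ.hom_i.tgt] at this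
    exact ((Δ.hom_j.src g).symm.trans (𝒟.src_mul _ _ _).symm).trans this
  have h2 : ℋ.tgt y = 𝒱.tgt f := by
    have := congrArg 𝒟.tgt hq
    rw [𝒟.tgt_mul, Δ.hom_j.tgt] at this
    exact ((Δ.hom_i.tgt y).symm.trans (𝒟.tgt_mul _ _ _).symm).trans this
  refine ⟨⟨h2.symm.trans (ℋ.src_inv y).symm, h1.symm, h, (ℋ.tgt_inv y).trans hgy.symm⟩, ?_⟩
  have key := 𝒟.mul_flip (tgt_inv_i h) (Δ.tgt_j_eq hgy)
    (by rw [𝒟.src_inv, Δ.hom_i.tgt, Δ.hom_j.src]; exact h1.symm)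
    (by rw [Δ.hom_i.tgt, Δ.hom_j.tgt]; exact h2.symm) hq.symm
  refine Eq.trans ?_ (key.trans ?_)
  · exact 𝒟.mul_congr (Gpd.inv_inv _).symm rfl _ _
  · exact 𝒟.mul_congr rfl (Δ.hom_i.map_inv y).symm _ _

/-- Converse of `mem_boxSet_of_Psi_eq`; it tells through which point the section of `Ψ` must pass
for the completed box to be `B`. -/
theorem Psi_of_box (B : Δ.boxSet) :
    Δ.Psi ⟨(right B, ℋ.inv (bot B)), (bot_right B).symm.trans (ℋ.src_inv _).symm⟩ =
      𝒟.mul (𝒟.inv (Δ.i (top B))) (Δ.j (left B)) (tgt_inv_i (top_left B)) := by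
  have key := 𝒟.mul_flip (Δ.tgt_i_eq (top_right B)) (Δ.tgt_j_eq (left_bot B))
    (by rw [Δ.hom_i.src, Δ.hom_j.src]; exact top_left B)
    (by rw [Δ.hom_i.tgt, Δ.hom_j.tgt]; exact (bot_right B).symm) (box_eq B)
  exact (key.trans (𝒟.mul_congr rfl (Δ.hom_i.map_inv _).symm _ _)).symm

theorem IsFactorization.surjective_doubleSource (hfac : Δ.IsFactorization) :
    Function.Surjective Δ.square.doubleSource := by
  rintro ⟨⟨x, f⟩, hxf⟩
  obtain ⟨g, y, hgy, e⟩ := hfac (𝒟.mul (𝒟.inv (Δ.i x)) (Δ.j f) (tgt_inv_i hxf))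
  exact ⟨⟨_, mem_boxSet_of_Psi_eq hxf (q := ⟨(g, y), hgy⟩) e⟩, rfl⟩

section Lie

open Manifold Filter Topology

variable {p v h d : ℕ}
  [TopologicalSpace V] [ChartedSpace (EuclideanSpace ℝ (Fin v)) V]
  [TopologicalSpace H] [ChartedSpace (EuclideanSpace ℝ (Fin h)) H]

section Sides

variable (A : SubmanifoldStructure (((𝓡 v).prod (𝓡 h)).prod ((𝓡 h).prod (𝓡 v))) Δ.boxSet)

theorem contMDiff_left : ContMDiff (𝓡 A.dim) (𝓡 v) ∞ (left : Δ.boxSet → V) :=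
  contMDiff_fst.comp (contMDiff_fst.comp A.contMDiff_val)

theorem contMDiff_bot : ContMDiff (𝓡 A.dim) (𝓡 h) ∞ (bot : Δ.boxSet → H) :=
  contMDiff_snd.comp (contMDiff_fst.comp A.contMDiff_val)

theorem contMDiff_top : ContMDiff (𝓡 A.dim) (𝓡 h) ∞ (top : Δ.boxSet → H) :=
  contMDiff_fst.comp (contMDiff_snd.comp A.contMDiff_val)

theorem contMDiff_right : ContMDiff (𝓡 A.dim) (𝓡 v) ∞ (right : Δ.boxSet → V) :=
  contMDiff_snd.comp (contMDiff_snd.comp A.contMDiff_val)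

theorem contMDiff_doubleSource
    (C : SubmanifoldStructure ((𝓡 h).prod (𝓡 v)) (cornerSet Δ.square.vert Δ.square.horiz)) :
    ContMDiff (𝓡 A.dim) (𝓡 C.dim) ∞ Δ.square.doubleSource :=
  C.contMDiff_iff.mpr ((contMDiff_top A).prodMk (contMDiff_left A))

theorem contMDiff_box_iff {E K Z : Type*} [NormedAddCommGroup E] [NormedSpace ℝ E]
    [TopologicalSpace K] {J : ModelWithCorners ℝ E K} [TopologicalSpace Z] [ChartedSpace K Z]
    {F : Z → Δ.boxSet} :
    ContMDiff J (𝓡 A.dim) ∞ F ↔ (ContMDiff J (𝓡 v) ∞ (fun z => left (F z)) ∧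
      ContMDiff J (𝓡 h) ∞ (fun z => bot (F z))) ∧
      ContMDiff J (𝓡 h) ∞ (fun z => top (F z)) ∧ ContMDiff J (𝓡 v) ∞ (fun z => right (F z)) :=
  ⟨fun hF => ⟨⟨(contMDiff_left A).comp hF, (contMDiff_bot A).comp hF⟩,
    (contMDiff_top A).comp hF, (contMDiff_right A).comp hF⟩,
    fun hF => A.contMDiff_iff.mpr ((hF.1.1.prodMk hF.1.2).prodMk (hF.2.1.prodMk hF.2.2))⟩

end Sides

variable [TopologicalSpace P] [ChartedSpace (EuclideanSpace ℝ (Fin p)) P]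
  [TopologicalSpace D] [ChartedSpace (EuclideanSpace ℝ (Fin d)) D]

/-- The set of boxes is the fibre product of `Ψ` and `Φ`. -/
theorem IsLie.nonempty_submanifoldStructure_boxSet (hΔ : Δ.IsLie p v h d)
    (htr : Δ.TransversalAtIdentities v h d) :
    Nonempty (SubmanifoldStructure (((𝓡 v).prod (𝓡 h)).prod ((𝓡 h).prod (𝓡 v))) Δ.boxSet) := by
  have := hΔ.horiz.arrows.isManifold
  have := hΔ.vert.arrows.isManifold
  obtain ⟨A₁⟩ := hΔ.nonempty_submanifoldStructure
  obtain ⟨A₂⟩ := hΔ.swap.nonempty_submanifoldStructure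
  have := A₁.isManifold
  have := A₂.isManifold
  obtain ⟨T⟩ := (hΔ.isSubmersion_Psi htr A₂).nonempty_submanifoldStructure (hΔ.contMDiff_Phi A₁)
  have := T.isManifold
  have hemb := (A₂.isSmoothEmbedding.prodMap A₁.isSmoothEmbedding).comp' T.isSmoothEmbedding
  obtain ⟨A, -⟩ := hemb.exists_submanifoldStructure (S := Δ.boxSet) (by
    ext q
    constructor
    · rintro ⟨⟨⟨q₂, q₁⟩, hq⟩, rfl⟩
      have e : Δ.Psi q₂ = Δ.Phi q₁ := hq
      -- Sources and ends of `Ψ = Φ` give the two corner conditions that are not built into the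
      -- fibre products.
      have hs := congrArg 𝒟.src e
      have ht := congrArg 𝒟.tgt e
      rw [Δ.src_Phi, show 𝒟.src (Δ.Psi q₂) = 𝒱.src q₂.1.1 from Δ.swap.src_Phi q₂] at hs
      rw [Δ.tgt_Phi, show 𝒟.tgt (Δ.Psi q₂) = ℋ.tgt q₂.1.2 from Δ.swap.tgt_Phi q₂] at ht
      exact ⟨⟨q₂.2, q₁.2, hs.symm, ht⟩, e.symm⟩
    · rintro ⟨hq, e⟩
      exact ⟨⟨(⟨q.1, hq.1⟩, ⟨q.2, hq.2.1⟩), e.symm⟩, rfl⟩)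
  exact ⟨A⟩

/-- Near the corner of `B`, a local section of `Ψ` factors `i(x)⁻¹ j(f)` smoothly as `j(g) i(y)`;
the box over `(x, f)` has right side `g` and bottom side `y⁻¹`. -/
theorem IsLie.hasLocalSectionAt_doubleSource (hΔ : Δ.IsLie p v h d)
    (htr : Δ.TransversalAtIdentities v h d)
    (A : SubmanifoldStructure (((𝓡 v).prod (𝓡 h)).prod ((𝓡 h).prod (𝓡 v))) Δ.boxSet)
    (C : SubmanifoldStructure ((𝓡 h).prod (𝓡 v)) (cornerSet Δ.square.vert Δ.square.horiz))
    (B : Δ.boxSet) :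
    HasLocalSectionAt (𝓡 A.dim) (𝓡 C.dim) Δ.square.doubleSource B := by
  obtain ⟨A₂⟩ := hΔ.swap.nonempty_submanifoldStructure
  have := A₂.isManifold
  obtain ⟨σ, hσ1, hσ2, hσ3⟩ := (hΔ.isSubmersion_Psi htr A₂).hasLocalSectionAt
    ⟨(right B, ℋ.inv (bot B)), (bot_right B).symm.trans (ℋ.src_inv _).symm⟩
  rw [Psi_of_box] at hσ1 hσ2 hσ3
  set a : cornerSet Δ.square.vert Δ.square.horiz → D := fun c =>
    𝒟.mul (𝒟.inv (Δ.i c.1.1)) (Δ.j c.1.2) (tgt_inv_i c.2) with ha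
  have has : ContMDiff (𝓡 C.dim) (𝓡 d) ∞ a := hΔ.diag.contMDiff_mul
    (hΔ.diag.inv_smooth.comp (hΔ.i_smooth.comp (contMDiff_fst.comp C.contMDiff_val)))
    (hΔ.j_smooth.comp (contMDiff_snd.comp C.contMDiff_val)) _
  set c₀ : cornerSet Δ.square.vert Δ.square.horiz := Δ.square.doubleSource B with hc₀
  have hσa : ContMDiffAt (𝓡 C.dim) (𝓡 A₂.dim) ∞ (fun c => σ (a c)) c₀ :=
    ContMDiffAt.comp c₀ hσ2 (has c₀)
  have hσv : ContMDiffAt (𝓡 C.dim) ((𝓡 v).prod (𝓡 h)) ∞ (fun c => (σ (a c)).1) c₀ :=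
    A₂.contMDiffAt_iff.mp hσa
  have hσe : ∀ᶠ c in 𝓝 c₀, Δ.Psi (σ (a c)) = a c := (has c₀).continuousAt.eventually hσ3
  have hval := C.contMDiff_val c₀
  obtain ⟨τ, hτ, hτe⟩ := A.exists_lift (x := c₀)
    (F := fun c => ((c.1.2, ℋ.inv (σ (a c)).1.2), (c.1.1, (σ (a c)).1.1)))
    ((hval.snd.prodMk ((hΔ.horiz.inv_smooth _).comp c₀ hσv.snd)).prodMk
      (hval.fst.prodMk hσv.fst))
    (hσe.mono fun c hc => mem_boxSet_of_Psi_eq (𝒱 := 𝒱) (ℋ := ℋ) c.2 hc)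
  refine ⟨τ, ?_, hτ, ?_⟩
  · refine Subtype.ext (hτe.self_of_nhds.trans ?_)
    have h1 : σ (a c₀) = _ := hσ1
    rw [h1]
    exact Prod.ext (Prod.ext rfl (Gpd.inv_inv _)) rfl
  · filter_upwards [hτe] with c hc
    refine Subtype.ext (Prod.ext ?_ ?_)
    · exact congrArg (fun q => q.2.1) hc
    · exact congrArg (fun q => q.1.1) hc

theorem IsLie.nonempty_submanifoldStructure_cornerSet (hΔ : Δ.IsLie p v h d) :
    Nonempty (SubmanifoldStructure ((𝓡 h).prod (𝓡 v))
      (cornerSet Δ.square.vert Δ.square.horiz)) := by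
  have := hΔ.horiz.arrows.isManifold
  have := hΔ.vert.arrows.isManifold
  exact hΔ.horiz.src_submersion.nonempty_submanifoldStructure hΔ.vert.src_submersion.contMDiff

/-- The left side is the double source followed by the projection `(x, f) ↦ f`, which has the local
section `f ↦ (X (t f), f)` for a local section `X` of `l`. -/
theorem IsLie.hasLocalSectionAt_left (hΔ : Δ.IsLie p v h d)
    (htr : Δ.TransversalAtIdentities v h d)
    (A : SubmanifoldStructure (((𝓡 v).prod (𝓡 h)).prod ((𝓡 h).prod (𝓡 v))) Δ.boxSet)
    (B : Δ.boxSet) : HasLocalSectionAt (𝓡 A.dim) (𝓡 v) (left : Δ.boxSet → V) B := by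
  obtain ⟨C⟩ := hΔ.nonempty_submanifoldStructure_cornerSet
  refine HasLocalSectionAt.comp (J := 𝓡 C.dim) (J' := 𝓡 v)
    (g := fun c : cornerSet Δ.square.vert Δ.square.horiz => c.1.2) ?_
    (hΔ.hasLocalSectionAt_doubleSource htr A C B)
  set c₀ : cornerSet Δ.square.vert Δ.square.horiz := Δ.square.doubleSource B with hc₀
  obtain ⟨X, hX1, hX2, hX3⟩ := hΔ.horiz.src_submersion.hasLocalSectionAt c₀.1.1
  have hc : ℋ.src c₀.1.1 = 𝒱.src c₀.1.2 := c₀.2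
  rw [hc] at hX1 hX2 hX3
  have hsrc := hΔ.vert.src_submersion.contMDiff c₀.1.2
  obtain ⟨τ, hτ, hτe⟩ := C.exists_lift (x := c₀.1.2) (F := fun f => (X (𝒱.src f), f))
    ((ContMDiffAt.comp c₀.1.2 hX2 hsrc).prodMk contMDiffAt_id)
    (hsrc.continuousAt.eventually hX3)
  exact ⟨τ, Subtype.ext (hτe.self_of_nhds.trans (Prod.ext hX1 rfl)), hτ,
    hτe.mono fun f hf => congrArg Prod.snd hf⟩

theorem IsLie.hasLocalSectionAt_top (hΔ : Δ.IsLie p v h d)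
    (htr : Δ.TransversalAtIdentities v h d)
    (A : SubmanifoldStructure (((𝓡 v).prod (𝓡 h)).prod ((𝓡 h).prod (𝓡 v))) Δ.boxSet)
    (B : Δ.boxSet) : HasLocalSectionAt (𝓡 A.dim) (𝓡 h) (top : Δ.boxSet → H) B := by
  obtain ⟨C⟩ := hΔ.nonempty_submanifoldStructure_cornerSet
  refine HasLocalSectionAt.comp (J := 𝓡 C.dim) (J' := 𝓡 h)
    (g := fun c : cornerSet Δ.square.vert Δ.square.horiz => c.1.1) ?_
    (hΔ.hasLocalSectionAt_doubleSource htr A C B)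
  set c₀ : cornerSet Δ.square.vert Δ.square.horiz := Δ.square.doubleSource B with hc₀
  obtain ⟨X, hX1, hX2, hX3⟩ := hΔ.vert.src_submersion.hasLocalSectionAt c₀.1.2
  have hc : 𝒱.src c₀.1.2 = ℋ.src c₀.1.1 := c₀.2.symm
  rw [hc] at hX1 hX2 hX3
  have hsrc := hΔ.horiz.src_submersion.contMDiff c₀.1.1
  obtain ⟨τ, hτ, hτe⟩ := C.exists_lift (x := c₀.1.1) (F := fun x => (x, X (ℋ.src x)))
    (contMDiffAt_id.prodMk (ContMDiffAt.comp c₀.1.1 hX2 hsrc))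
    ((hsrc.continuousAt.eventually hX3).mono fun x hx => hx.symm)
  exact ⟨τ, Subtype.ext (hτe.self_of_nhds.trans (Prod.ext rfl hX1)), hτ,
    hτe.mono fun f hf => congrArg Prod.fst hf⟩

theorem IsLie.isSmoothManifold_boxSet (hΔ : Δ.IsLie p v h d)
    (A : SubmanifoldStructure (((𝓡 v).prod (𝓡 h)).prod ((𝓡 h).prod (𝓡 v))) Δ.boxSet) :
    IsSmoothManifold A.dim Δ.boxSet := by
  have := hΔ.horiz.arrows.t2
  have := hΔ.vert.arrows.t2
  have := hΔ.horiz.arrows.secondCountable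
  have := hΔ.vert.arrows.secondCountable
  -- Both topological conditions pass to subspaces of products.
  exact ⟨inferInstance, inferInstance, A.isManifold⟩

theorem IsLie.isLie_horGpd (hΔ : Δ.IsLie p v h d) (htr : Δ.TransversalAtIdentities v h d)
    (A : SubmanifoldStructure (((𝓡 v).prod (𝓡 h)).prod ((𝓡 h).prod (𝓡 v))) Δ.boxSet) :
    Δ.horGpd.IsLie v A.dim := by
  refine Gpd.IsLie.of_hasLocalSectionAt hΔ.vert.arrows (hΔ.isSmoothManifold_boxSet A)
    (contMDiff_left A) (hΔ.hasLocalSectionAt_left htr A) ?_ ?_ fun C => ?_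
  · exact (contMDiff_box_iff A).mpr ⟨⟨contMDiff_id,
      hΔ.horiz.one_smooth.comp hΔ.vert.tgt_submersion.contMDiff⟩,
      hΔ.horiz.one_smooth.comp hΔ.vert.src_submersion.contMDiff, contMDiff_id⟩
  · exact (contMDiff_box_iff A).mpr ⟨⟨contMDiff_right A,
      hΔ.horiz.inv_smooth.comp (contMDiff_bot A)⟩,
      hΔ.horiz.inv_smooth.comp (contMDiff_top A), contMDiff_left A⟩
  · have h1 := contMDiff_fst.comp C.contMDiff_val
    have h2 := contMDiff_snd.comp C.contMDiff_val
    have h3 := (contMDiff_left A).comp h1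
    have h4 := (contMDiff_right A).comp h2
    exact (contMDiff_box_iff A).mpr ⟨⟨h3,
      hΔ.horiz.contMDiff_mul ((contMDiff_bot A).comp h1) ((contMDiff_bot A).comp h2) _⟩,
      hΔ.horiz.contMDiff_mul ((contMDiff_top A).comp h1) ((contMDiff_top A).comp h2) _, h4⟩

theorem IsLie.isLie_verGpd (hΔ : Δ.IsLie p v h d) (htr : Δ.TransversalAtIdentities v h d)
    (A : SubmanifoldStructure (((𝓡 v).prod (𝓡 h)).prod ((𝓡 h).prod (𝓡 v))) Δ.boxSet) :
    Δ.verGpd.IsLie h A.dim := by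
  refine Gpd.IsLie.of_hasLocalSectionAt hΔ.horiz.arrows (hΔ.isSmoothManifold_boxSet A)
    (contMDiff_top A) (hΔ.hasLocalSectionAt_top htr A) ?_ ?_ fun C => ?_
  · exact (contMDiff_box_iff A).mpr ⟨⟨hΔ.vert.one_smooth.comp hΔ.horiz.src_submersion.contMDiff,
      contMDiff_id⟩, contMDiff_id, hΔ.vert.one_smooth.comp hΔ.horiz.tgt_submersion.contMDiff⟩
  · exact (contMDiff_box_iff A).mpr ⟨⟨hΔ.vert.inv_smooth.comp (contMDiff_left A),
      contMDiff_top A⟩, contMDiff_bot A, hΔ.vert.inv_smooth.comp (contMDiff_right A)⟩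
  · have h1 := contMDiff_fst.comp C.contMDiff_val
    have h2 := contMDiff_snd.comp C.contMDiff_val
    have h3 := (contMDiff_bot A).comp h2
    have h4 := (contMDiff_top A).comp h1
    exact (contMDiff_box_iff A).mpr ⟨⟨
      hΔ.vert.contMDiff_mul ((contMDiff_left A).comp h1) ((contMDiff_left A).comp h2) _, h3⟩, h4,
      hΔ.vert.contMDiff_mul ((contMDiff_right A).comp h1) ((contMDiff_right A).comp h2) _⟩

theorem IsLie.isLie_square (hΔ : Δ.IsLie p v h d) (htr : Δ.TransversalAtIdentities v h d)
    (hfac : Δ.IsFactorization)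
    (A : SubmanifoldStructure (((𝓡 v).prod (𝓡 h)).prod ((𝓡 h).prod (𝓡 v))) Δ.boxSet) :
    Δ.square.IsLie p v h A.dim := by
  obtain ⟨C⟩ := hΔ.nonempty_submanifoldStructure_cornerSet
  have := A.isManifold
  have := C.isManifold
  exact ⟨hΔ.vert, hΔ.horiz, hΔ.isLie_horGpd htr A, hΔ.isLie_verGpd htr A,
    hfac.surjective_doubleSource, C, (contMDiff_doubleSource A C).isSubmersion_of_hasLocalSectionAt
      (hΔ.hasLocalSectionAt_doubleSource htr A C)⟩

end Lie

end GpdDiagram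
theorem theorem2 {P V H D : Type*} (p v h d : ℕ)
    [TopologicalSpace P] [ChartedSpace (EuclideanSpace ℝ (Fin p)) P]
    [TopologicalSpace V] [ChartedSpace (EuclideanSpace ℝ (Fin v)) V]
    [TopologicalSpace H] [ChartedSpace (EuclideanSpace ℝ (Fin h)) H]
    [TopologicalSpace D] [ChartedSpace (EuclideanSpace ℝ (Fin d)) D]
    (𝒱 : Gpd P V) (ℋ : Gpd P H) (𝒟 : Gpd P D) (Δ : GpdDiagram 𝒱 ℋ 𝒟)
    (hΔ : Δ.IsLie p v h d) (htr : Δ.TransversalAtIdentities v h d) :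
    (∃ A : SubmanifoldStructure ((𝓡 h).prod (𝓡 v)) {q : H × V | ℋ.tgt q.1 = 𝒱.src q.2},
      Manifold.IsSubmersion (𝓡 A.dim) (𝓡 d) ∞ Δ.Phi) ∧
    (∃ A : SubmanifoldStructure ((𝓡 v).prod (𝓡 h)) {q : V × H | 𝒱.tgt q.1 = ℋ.src q.2},
      Manifold.IsSubmersion (𝓡 A.dim) (𝓡 d) ∞ Δ.Psi) ∧
    (Δ.IsFactorization →
      (∃ A : SubmanifoldStructure (((𝓡 v).prod (𝓡 h)).prod ((𝓡 h).prod (𝓡 v))) Δ.boxSet,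
        Δ.square.IsLie p v h A.dim) ∧
      Δ.square.IsSlim) := by
  obtain ⟨A₁⟩ := hΔ.nonempty_submanifoldStructure
  obtain ⟨A₂⟩ := hΔ.swap.nonempty_submanifoldStructure
  obtain ⟨A⟩ := hΔ.nonempty_submanifoldStructure_boxSet htr
  exact ⟨⟨A₁, hΔ.isSubmersion_Phi htr A₁⟩, ⟨A₂, hΔ.isSubmersion_Psi htr A₂⟩,
    fun hfac => ⟨⟨A, hΔ.isLie_square htr hfac A⟩, Δ.isSlim_square⟩⟩
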